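/- **Setting.** Let $G=(V,E)$ be a finite connected graph with positive edge lengths, shortest-path distance $\mathrm{dist}$, aspect ratio $\alpha$ (maximum over minimum distance), and let $c=4+\lambda$ with $0<\lambda\le4$. Let $k$ be the highway dimension of $G$ of violation $\lambda$: the smallest $k$ such that for all $r>0$ every ball $B_{cr}(v)$ contains at most $k$ vertices hitting all shortest paths inside $B_{cr}(v)$ of length more than $r$. Lengths are scaled so that the minimum distance lies in $(c/2,c]$. Put $r_i=(c/4)^i$. For every level $i\ge0$ let $\mathrm{SPC}(r_i)\subseteq V$ be an inclusion-wise minimal set hitting all shortest paths of length in $(r_i,cr_i/2]$, such that no ball of radius $cr_i/2$ contains more than $s$ of its vertices. A *town on level $i$* is a ball $B_{r_i}(v)$ with $\mathrm{dist}(v,h)>2r_i$ for all $h\in\mathrm{SPC}(r_i)$; the *sprawl* $S_i$ is the set of vertices in no town on level $i$. Let $\mathcal T$ be the family of all towns; the *level* of $T\in\mathcal T$ is the least $i$ such that $T$ is a town on level $i$, and its child towns are the maximal towns properly contained in it. **Construction.** Let $0<\varepsilon\le1$, let $d\ge1$ with $d=O(\log(2+ks\log(2+1/\varepsilon)/\lambda)/\lambda)$,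 and let $\beta=\Omega(\varepsilon^2/(d\log(2+\alpha)))$. The embedding $H_T$ and the rooted tree of bags $D_T$ of a town $T$ of level $j$ are built recursively. * If $j=0$, then $T$ is a single vertex, and $D_T$ is the single bag $T$. * If $j\ge1$, let $C_j=T$ and $C_i=S_i\cap C_{i+1}$. For $i=1,\dots,j-1$, each $h\in C_i\cap\mathrm{SPC}(r_i)$ contributes to the set $X_T^i$ one vertex: some $h'\in\bigcup_{1\le l<i}X_T^l$ with $\mathrm{dist}(h,h')\le\varepsilon r_i$ if there is one, and $h$ otherwise. Let $X_T=\bigcup_{i=1}^{j-1} X^i_T$, and let $Y_T$ contain one vertex of $X_T\cap T'$ (representing $X_T\cap T'$) for each child town $T'$ meeting $X_T$. * Take a split-tree decomposition of $Y_T$ with levels $0,\dots,\bar j$, where $\bar j=\max\{0,\lceil\log_2\mathrm{diam}(Y_T)\rceil\}$ (and $\bar j=0$ if $Y_T$ is a single vertex): the clusters of each level partition $Y_T$ and refine those of the next level, the clusters of level $\bar\imath$ have diameter at most $2^{\bar\imath+1}$, those of level $0$ are single vertices, and that of level $\bar j$ is $Y_T$. The bag of a level-$\bar\imath$ cluster is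 a $\beta2^{\bar\imath}$-net of it, and every vertex of a bag is also in a bag of a child cluster. Replacing each vertex by all vertices of $X_T$ that it represents gives the tree of bags $D_X$. The graph $H_X$ has a complete graph on every bag of $D_X$. * For a child town $T'$, let $i$ be the level such that the distance from $T'$ to its closest sibling is in $(r_i,r_{i+1}]$. Its connecting bag $b$ is the bag of $D_X$ on level $\min\{\bar j,\max\{0,\lceil\log_2r_i\rceil+\lceil\log_2(1/\varepsilon)+\log_2d\rceil\}\}$ whose (expanded) cluster contains a vertex of $X_T$ closest to $T'$. * $H_T$ consists of $H_X$, all $H_{T'}$, and all edges between $T'$ and its connecting bag $b$, for all child towns $T'$; each edge $\{u,v\}$ has length $\mathrm{dist}(u,v)$. $D_T$ is obtained from $D_X$ and all $D_{T'}$ by making the root of $D_{T'}$ a child of $b$, adding all vertices of $b$ (as a bag of $D_X$) to each bag of $D_{T'}$, and adding $X_T\cap T'$ to each bag of $D_{T'}$, to $b$, and to all descendants of $b$ in $D_X$. **Theorem.** The construction can always be carried out. For every outcome of its random and arbitrary choices and every town $T\in\mathcal T$ of level $j$, $D_T$ is a valid tree decomposition of $H_T$, and the width of $D_T$, hence the treewidth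 of $H_T$, is at most $$ j\cdot\big(\log(2+\alpha)\big)^{K\log^2\left(2+\frac{ks}{\varepsilon\lambda}\right)/\lambda}. $$ Moreover $V$ is a town, and if $s=O(k\log(2+k))$, then the treewidth of the embedding $H_V$ of $G$ is at most $$ \big(\log(2+\alpha)\big)^{K\log^2\left(2+\frac{k}{\varepsilon\lambda}\right)/\lambda}. $$ Here $K>0$ depends only on the constants hidden in the $O$ and $\Omega$ of the assumptions on $d$, $\beta$ and $s$. -/

import Mathlib

noncomputable section

/-- An edge-weighted graph: a simple graph together with a length for every edge. -/
structure WGraph (V : Type*) where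
  graph : SimpleGraph V
  len : Sym2 V → ℝ

namespace WGraph

variable {V : Type*} (G : WGraph V)

/-- The length of a walk. -/
def walkLen {u v : V} (p : G.graph.Walk u v) : ℝ := (p.edges.map G.len).sum

/-- The shortest-path distance. -/
def dist (u v : V) : ℝ := sInf (Set.range fun p : G.graph.Walk u v => G.walkLen p)

theorem dist_comm (u v : V) : G.dist u v = G.dist v u := by
  have key : ∀ a b : V, Set.range (fun p : G.graph.Walk a b => G.walkLen p) ⊆
      Set.range (fun p : G.graph.Walk b a => G.walkLen p) := by
    rintro a b _ ⟨p, rfl⟩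
    refine ⟨p.reverse, ?_⟩
    simp [walkLen, List.sum_reverse]
  unfold dist
  rw [Set.Subset.antisymm (key u v) (key v u)]

/-- `p` is a shortest path between its end vertices. -/
def IsShortestPath {u v : V} (p : G.graph.Walk u v) : Prop :=
  p.IsPath ∧ G.walkLen p = G.dist u v

/-- The closed ball `B_r(v)`. -/
def ball (v : V) (r : ℝ) : Set V := {u | G.dist u v ≤ r}

/-- The distance between two vertex sets. -/
def setDist (A B : Set V) : ℝ := sInf {x | ∃ u ∈ A, ∃ v ∈ B, x = G.dist u v}

/-- The diameter of a vertex set. -/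
def diam (A : Set V) : ℝ := sSup {x | ∃ u ∈ A, ∃ v ∈ A, x = G.dist u v}

/-- The smallest distance between two different vertices. -/
def minDist : ℝ := sInf {x | ∃ u v : V, u ≠ v ∧ x = G.dist u v}

/-- Maximum distance divided by minimum distance. -/
def aspectRatio : ℝ := G.diam Set.univ / G.minDist

/-- The highway dimension for the constant `c`: the smallest `k` such that for all `r > 0`, in
every ball of radius `c * r` there are at most `k` vertices that hit all shortest paths inside the
ball of length more than `r`. -/
def highwayDimension (c : ℝ) : ℕ :=
  sInf {k | ∀ r : ℝ, 0 < r → ∀ v : V, ∃ K : Set V, K ⊆ G.ball v (c * r) ∧ K.ncard ≤ k ∧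
    ∀ (x y : V) (p : G.graph.Walk x y), G.IsShortestPath p →
      (∀ z ∈ p.support, z ∈ G.ball v (c * r)) → r < G.walkLen p → ∃ h ∈ K, h ∈ p.support}

/-- `S` is a shortest path cover for scale `r`. -/
def IsSPC (c r : ℝ) (S : Set V) : Prop :=
  ∀ (x y : V) (p : G.graph.Walk x y), G.IsShortestPath p →
    r < G.walkLen p → G.walkLen p ≤ c * r / 2 → ∃ h ∈ S, h ∈ p.support

/-- No ball of radius `c * r / 2` contains more than `s` vertices of `S`. -/
def LocallySparse (c r : ℝ) (s : ℕ) (S : Set V) : Prop :=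
  ∀ v : V, (S ∩ G.ball v (c * r / 2)).ncard ≤ s

/-- `N` is a `δ`-net of `S`. -/
def IsNet (δ : ℝ) (N S : Set V) : Prop :=
  N ⊆ S ∧ (∀ u ∈ S, ∃ v ∈ N, G.dist u v ≤ δ) ∧ ∀ u ∈ N, ∀ v ∈ N, u ≠ v → δ < G.dist u v

/-- `cl` is a split-tree decomposition of the metric on `Y`, with levels `0, …, top`; `cl i y` is
the cluster of level `i` that contains `y`. The clusters of a level partition `Y`, they are
refined by those of the next lower level, the highest cluster is `Y`, the lowest ones are single
vertices, and the diameter bound `2 ^ (i + 1)` halves from each level to the next lower one. -/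
structure IsSplitTree (Y : Set V) (top : ℕ) (cl : ℕ → V → Set V) : Prop where
  self_mem : ∀ i ≤ top, ∀ y ∈ Y, y ∈ cl i y
  subset : ∀ i ≤ top, ∀ y ∈ Y, cl i y ⊆ Y
  partition : ∀ i ≤ top, ∀ y ∈ Y, ∀ z ∈ cl i y, cl i z = cl i y
  refine_succ : ∀ i < top, ∀ y ∈ Y, cl i y ⊆ cl (i + 1) y
  highest : ∀ y ∈ Y, cl top y = Y
  lowest : ∀ y ∈ Y, cl 0 y = {y}
  diam_le : ∀ i ≤ top, ∀ y ∈ Y, ∀ z ∈ cl i y, ∀ z' ∈ cl i y, G.dist z z' ≤ 2 ^ (i + 1)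

end WGraph

/-! ### Tree decompositions -/

/-- `(D, bag)` is a tree decomposition of the graph with vertex set `S` and edges those of `H`. -/
structure IsTreeDecomposition {V ι : Type*} (S : Set V) (H : SimpleGraph V)
    (D : SimpleGraph ι) (bag : ι → Set V) : Prop where
  isTree : D.IsTree
  union_eq : ⋃ n, bag n = S
  edge : ∀ u v, H.Adj u v → ∃ n, u ∈ bag n ∧ v ∈ bag n
  connected : ∀ v ∈ S, (D.induce {n | v ∈ bag n}).Connected

/-- The treewidth of the graph with vertex set `S` and edges those of `H`. -/
def treewidth {V : Type*} (S : Set V) (H : SimpleGraph V) : ℕ :=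
  sInf {w | ∃ (n : ℕ) (D : SimpleGraph (Fin n)) (bag : Fin n → Set V),
    IsTreeDecomposition S H D bag ∧ ∀ i, (bag i).ncard - 1 ≤ w}

/-! ### Towns, sprawl and cores -/

/-- The input of the construction: the graph, the constant `c`, the shortest path covers of all
levels, the stretch parameter `ε`, the bound `d` used for the doubling dimension of the
approximate core hubs, and the coarseness `β` of the nets. -/
structure Setup (V : Type*) where
  G : WGraph V
  c : ℝ
  spc : ℕ → Set V
  ε : ℝ
  d : ℝ
  β : ℝ

namespace Setup

variable {V : Type*} (P : Setup V)

/-- The scale of level `i`. -/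
def r (i : ℕ) : ℝ := (P.c / 4) ^ i

/-- `T` is a town for the shortest path cover of level `i`. -/
def IsTownOn (i : ℕ) (T : Set V) : Prop :=
  ∃ v : V, (∀ h ∈ P.spc i, 2 * P.r i < P.G.dist v h) ∧ T = P.G.ball v (P.r i)

/-- The sprawl of level `i`. -/
def sprawl (i : ℕ) : Set V := {v | ∀ T, P.IsTownOn i T → v ∉ T}

/-- The towns decomposition: all towns on all levels. -/
def IsTown (T : Set V) : Prop := ∃ i, P.IsTownOn i T

/-- The level of a town: the lowest level on which the set is a town. -/
def level (T : Set V) : ℕ := sInf {i | P.IsTownOn i T}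

/-- `A` is a child town of `T`. -/
def IsChild (A T : Set V) : Prop :=
  P.IsTown A ∧ P.IsTown T ∧ A ⊂ T ∧ ∀ B, P.IsTown B → A ⊂ B → ¬ B ⊂ T

/-- The core of `T` on level `i`: `T` intersected with the sprawls of the levels
`i, …, level T - 1`. -/
def core (T : Set V) (i : ℕ) : Set V := {v ∈ T | ∀ l, i ≤ l → l < P.level T → v ∈ P.sprawl l}

/-- The distance from the child town `A` of `T` to its closest sibling. -/
def siblingDist (T A : Set V) : ℝ :=
  sInf {x | ∃ B, P.IsChild B T ∧ B ≠ A ∧ x = P.G.setDist A B}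

/-- The level `i` for which the distance to the closest sibling lies in `(r i, r (i + 1)]`. -/
def siblingLevel (T A : Set V) : ℕ := sInf {i | P.siblingDist T A ≤ P.r (i + 1)}

end Setup

/-! ### The recursive construction -/

/-- All choices, random or arbitrary, that are made while the embedding is computed, for every
town `T`:
`shift T i h` is the approximate core hub to which the core hub `h` of level `i` is moved;
`rep T x` is the representative of the approximate core hub `x`;
`cl T` is the split-tree decomposition of the set of representatives;
`net T i C` is the net of the cluster `C` of level `i`;
`hub T A` is the closest approximate core hub of `T` to the child town `A`. -/
structure Choices (V : Type*) where
  shift : Set V → ℕ → V → V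
  rep : Set V → V → V
  cl : Set V → ℕ → V → Set V
  net : Set V → ℕ → Set V → Set V
  hub : Set V → Set V → V

/-- Names for the bags: `(U, i, C)` belongs to the cluster `C` of level `i` in the split-tree
decomposition for the town `U`. -/
abbrev BagName (V : Type*) := Set V × ℕ × Set V

namespace Choices

variable {V : Type*} (R : Choices V) (P : Setup V)

/-- The approximate core hubs of `T` on level `i`. -/
def XLevel (T : Set V) (i : ℕ) : Set V := R.shift T i '' (P.core T i ∩ P.spc i)

/-- The approximate core hubs `X_T`. -/
def X (T : Set V) : Set V := {x | ∃ i, 1 ≤ i ∧ i < P.level T ∧ x ∈ R.XLevel P T i}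

/-- The representatives `Y_T`. -/
def Y (T : Set V) : Set V := R.rep T '' R.X P T

/-- Replace each representative in `Z` by all approximate core hubs that it represents. -/
def expand (T Z : Set V) : Set V := {x ∈ R.X P T | R.rep T x ∈ Z}

/-- The highest level of the split-tree decomposition of `Y_T`. -/
def top (T : Set V) : ℕ := ⌈Real.logb 2 (P.G.diam (R.Y P T))⌉₊

/-- The level of the connecting bag of the child town `A` of `T`. -/
def connLevel (T A : Set V) : ℕ :=
  min (R.top P T) (⌈Real.logb 2 (P.r (P.siblingLevel T A))⌉ +
    ⌈Real.logb 2 (1 / P.ε) + Real.logb 2 P.d⌉).toNat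

/-- The cluster of `Y_T` that corresponds to the connecting bag of the child town `A` of `T`. -/
def connCluster (T A : Set V) : Set V := R.cl T (R.connLevel P T A) (R.rep T (R.hub T A))

/-- The bag of `D_X` for the cluster `C` of level `i`. -/
def coreBag (T : Set V) (i : ℕ) (C : Set V) : Set V := R.expand P T (R.net T i C)

/-- The connecting bag of the child town `A` of `T` in `D_X`. -/
def connBag (T A : Set V) : Set V := R.coreBag P T (R.connLevel P T A) (R.connCluster P T A)

/-- The choices made for the town `T` are possible ones. -/
structure ValidAt (T : Set V) : Prop where
  /-- A core hub of level `i` is moved to an approximate core hub of a lower level at distance at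
  most `ε * r i` if there is one, and stays where it is otherwise. -/
  shift_lower : ∀ i, 1 ≤ i → i < P.level T → ∀ h ∈ P.core T i ∩ P.spc i,
    (∃ l, 1 ≤ l ∧ l < i ∧ ∃ h' ∈ R.XLevel P T l, P.G.dist h h' ≤ P.ε * P.r i) →
      (∃ l, 1 ≤ l ∧ l < i ∧ R.shift T i h ∈ R.XLevel P T l) ∧
        P.G.dist h (R.shift T i h) ≤ P.ε * P.r i
  shift_self : ∀ i, 1 ≤ i → i < P.level T → ∀ h ∈ P.core T i ∩ P.spc i,
    (¬ ∃ l, 1 ≤ l ∧ l < i ∧ ∃ h' ∈ R.XLevel P T l, P.G.dist h h' ≤ P.ε * P.r i) →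
      R.shift T i h = h
  /-- Each child town that contains approximate core hubs has one of them as representative. -/
  rep_mem : ∀ x ∈ R.X P T, R.rep T x ∈ R.X P T
  rep_child : ∀ A, P.IsChild A T → ∀ x ∈ R.X P T, x ∈ A → R.rep T x ∈ A
  rep_eq : ∀ A, P.IsChild A T → ∀ x ∈ R.X P T, ∀ y ∈ R.X P T, x ∈ A → y ∈ A →
    R.rep T x = R.rep T y
  splitTree : P.G.IsSplitTree (R.Y P T) (R.top P T) (R.cl T)
  isNet : ∀ i ≤ R.top P T, ∀ y ∈ R.Y P T,
    P.G.IsNet (P.β * 2 ^ i) (R.net T i (R.cl T i y)) (R.cl T i y)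
  /-- The nets form a hierarchy: a vertex in a net is also in the net of a child cluster. -/
  hierarchy : ∀ i < R.top P T, ∀ y ∈ R.Y P T, ∀ v ∈ R.net T (i + 1) (R.cl T (i + 1) y),
    ∃ z ∈ R.cl T (i + 1) y, v ∈ R.net T i (R.cl T i z)
  hub_mem : ∀ A, P.IsChild A T → R.hub T A ∈ R.X P T
  hub_closest : ∀ A, P.IsChild A T → ∀ x ∈ R.X P T,
    P.G.setDist A {R.hub T A} ≤ P.G.setDist A {x}

/-- A possible outcome of all choices. Towns of level `0` need none. -/
def Valid : Prop := ∀ T, P.IsTown T → P.level T ≠ 0 → R.ValidAt P T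

/-- `IsCoreName T i C`: there is a bag for the cluster `C` of level `i` in `D_X`. -/
def IsCoreName (T : Set V) (i : ℕ) (C : Set V) : Prop :=
  P.level T ≠ 0 ∧ i ≤ R.top P T ∧ ∃ y ∈ R.Y P T, C = R.cl T i y

/-- The name of the root bag of `D_T`. -/
def rootName (T : Set V) : BagName V :=
  if P.level T = 0 then (T, 0, T) else (T, R.top P T, R.Y P T)

/-- The names of the bags of `D_T`. -/
inductive IsName : Set V → BagName V → Prop
  | single {T : Set V} : P.level T = 0 → IsName T (T, 0, T)
  | core {T : Set V} {i : ℕ} {C : Set V} : R.IsCoreName P T i C → IsName T (T, i, C)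
  | child {A T : Set V} {n : BagName V} : P.IsChild A T → IsName A n → IsName T n

/-- `IsParent T m n`: in the rooted tree `D_T`, the bag `n` is the parent of the bag `m`. -/
inductive IsParent : Set V → BagName V → BagName V → Prop
  /-- `D_X` has the shape of the split tree. -/
  | core {T : Set V} {i : ℕ} {y : V} : P.level T ≠ 0 → i < R.top P T → y ∈ R.Y P T →
      IsParent T (T, i, R.cl T i y) (T, i + 1, R.cl T (i + 1) y)
  | child {A T : Set V} {m n : BagName V} : P.IsChild A T → IsParent A m n → IsParent T m n
  /-- The root of `D_A` is attached to the connecting bag of the child town `A`. -/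
  | join {A T : Set V} : P.IsChild A T →
      IsParent T (R.rootName P A) (T, R.connLevel P T A, R.connCluster P T A)

/-- `InBag T n v`: the vertex `v` is in the bag `n` of the final tree decomposition `D_T`. -/
inductive InBag : Set V → BagName V → V → Prop
  | single {T : Set V} {v : V} : P.level T = 0 → v ∈ T → InBag T (T, 0, T) v
  /-- The bags of `D_X`. -/
  | core {T : Set V} {i : ℕ} {C : Set V} {v : V} : R.IsCoreName P T i C →
      v ∈ R.coreBag P T i C → InBag T (T, i, C) v
  /-- The bags of `D_A` for a child town `A`. -/
  | child {A T : Set V} {n : BagName V} {v : V} : P.IsChild A T → InBag A n v → InBag T n v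
  /-- All vertices of the connecting bag of `A` are added to each bag of `D_A`. -/
  | addConn {A T : Set V} {n : BagName V} {v : V} : P.IsChild A T → R.IsName P A n →
      v ∈ R.connBag P T A → InBag T n v
  /-- All approximate core hubs of `T` inside `A` are added to each bag of `D_A`. -/
  | addHubs {A T : Set V} {n : BagName V} {v : V} : P.IsChild A T → R.IsName P A n →
      v ∈ R.X P T ∩ A → InBag T n v
  /-- They are also added to the connecting bag of `A` and to its descendants in `D_X`. -/
  | addHubsCore {A T : Set V} {i : ℕ} {C : Set V} {v : V} : P.IsChild A T →
      R.IsCoreName P T i C → i ≤ R.connLevel P T A → C ⊆ R.connCluster P T A →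
      v ∈ R.X P T ∩ A → InBag T (T, i, C) v

/-- The edges of the embedding `H_T` (up to symmetry, and apart from loops). -/
inductive IsEdge : Set V → V → V → Prop
  /-- `H_X` has a complete graph on each bag of `D_X`. -/
  | core {T : Set V} {i : ℕ} {C : Set V} {u v : V} : R.IsCoreName P T i C →
      u ∈ R.coreBag P T i C → v ∈ R.coreBag P T i C → IsEdge T u v
  /-- The edges of `H_A` for a child town `A`. -/
  | child {A T : Set V} {u v : V} : P.IsChild A T → IsEdge A u v → IsEdge T u v
  /-- Every vertex of `A` is joined to every vertex of the connecting bag of `A`. -/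
  | join {A T : Set V} {u v : V} : P.IsChild A T → u ∈ A → v ∈ R.connBag P T A → IsEdge T u v

/-- The embedding `H_T` of the town `T`; its vertex set is `T`, and each edge is as long as the
distance of its end vertices in the input graph. -/
def embedding (T : Set V) : WGraph V where
  graph := SimpleGraph.fromRel (R.IsEdge P T)
  len := Sym2.lift ⟨P.G.dist, P.G.dist_comm⟩

/-- The underlying tree of `D_T`. -/
def decompTree (T : Set V) : SimpleGraph {n : BagName V // R.IsName P T n} :=
  SimpleGraph.fromRel fun m n => R.IsParent P T m.1 n.1

/-- The bags of `D_T`. -/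
def decompBag (T : Set V) (n : {n : BagName V // R.IsName P T n}) : Set V :=
  {v | R.InBag P T n.1 v}

end Choices

end

/-! Towns form a laminar family. A short distance from a vertex of a town on level `i` to a vertex
outside it, or a long one inside it, gives a shortest path of length in `(r i, 2 * r i]`; such a
path is hit by a hub within `2 * r i` of the centre, which is forbidden. Hence a town on level `i`
has diameter at most `r i`, vertices outside are farther than `r i` from it, intersecting towns are
nested, and everything can be proved by induction over child towns (`town_induction`).

Validity of the decomposition rests on `exists_highest_bag`. A vertex `v` of `T` lies in a unique
child town `A`. If it is no approximate core hub of `T`, it occurs in `D_A` only. Otherwise the bags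
of `D_X` with `v` are a path of clusters around its representative, as long as the nets contain that
representative, and the subtree below the connecting bag of `A`. The two fit together because the
connecting cluster contains the representative of `v` (`rep_hub_eq`). The other child decompositions
contain `v` in all bags or in none, according to their connecting bags.

The width bound comes from a covering argument. In a ball the sprawl of one level is covered by
`coverNumber` many balls one scale smaller (`exists_cover`); iterating this over the levels of a
core gives a packing bound `F` for approximate core hubs (`ncard_packing_le`). It applies to nets,
to the hubs inside one child town, and to the child towns with hubs whose connecting bags lie on one
level above a given bag. So each level of the towns hierarchy adds at most `(t + 3) * F ^ 2`
vertices to a bag, where `t` bounds the number of levels of the split trees, which is logarithmic in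
the aspect ratio (`ncard_bag_le`).

Finally, with `q = log (2 + k s / (ε λ))`, it suffices to separate scales by `W = O((1 + q + log log
(2 + α)) / λ)` levels (`exists_levels`), and `log F = O(q (W + 1))`. As `q`, `1 / λ` and `log log (2
+ α)` are bounded away from zero, everything is absorbed by `log log (2 + α) * q ^ 2 / λ`.

That the choices can be made at all is shown with a trivial split tree (`valid_greedyChoices`), once
`exists_coreHub` provides a hub to connect to. -/

namespace WGraph

variable {V : Type*} {G : WGraph V}

/-! ### Shortest paths and distances -/

theorem len_nonneg_of_mem_edges (hpos : ∀ e ∈ G.graph.edgeSet, 0 < G.len e) {u v : V}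
    (p : G.graph.Walk u v) : ∀ x ∈ p.edges.map G.len, 0 ≤ x := by
  intro x hx
  obtain ⟨e, he, rfl⟩ := List.mem_map.1 hx
  exact (hpos e (p.edges_subset_edgeSet he)).le

theorem walkLen_nonneg (hpos : ∀ e ∈ G.graph.edgeSet, 0 < G.len e) {u v : V}
    (p : G.graph.Walk u v) : 0 ≤ G.walkLen p :=
  List.sum_nonneg (len_nonneg_of_mem_edges hpos p)

theorem walkLen_append {u v w : V} (p : G.graph.Walk u v) (q : G.graph.Walk v w) :
    G.walkLen (p.append q) = G.walkLen p + G.walkLen q := by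
  simp [walkLen]

theorem bddBelow_walkLen (hpos : ∀ e ∈ G.graph.edgeSet, 0 < G.len e) (u v : V) :
    BddBelow (Set.range fun p : G.graph.Walk u v => G.walkLen p) :=
  ⟨0, by rintro _ ⟨p, rfl⟩; exact walkLen_nonneg hpos p⟩

theorem dist_le_walkLen (hpos : ∀ e ∈ G.graph.edgeSet, 0 < G.len e) {u v : V}
    (p : G.graph.Walk u v) : G.dist u v ≤ G.walkLen p :=
  csInf_le (bddBelow_walkLen hpos u v) ⟨p, rfl⟩

theorem walkLen_bypass_le [DecidableEq V] (hpos : ∀ e ∈ G.graph.edgeSet, 0 < G.len e) {u v : V}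
    (p : G.graph.Walk u v) : G.walkLen p.bypass ≤ G.walkLen p :=
  (p.edges_bypass_sublist_edges.map G.len).sum_le_sum (len_nonneg_of_mem_edges hpos p)

/-- There are finitely many simple paths, and shortcutting a walk to a simple path does not lengthen
it, so the infimum over all walks is attained. -/
theorem exists_isShortestPath [Finite V] (hconn : G.graph.Connected)
    (hpos : ∀ e ∈ G.graph.edgeSet, 0 < G.len e) (u v : V) :
    ∃ p : G.graph.Walk u v, G.IsShortestPath p := by
  classical
  have := Fintype.ofFinite V
  have : DecidableRel G.graph.Adj := Classical.decRel _
  obtain ⟨w⟩ := hconn.preconnected u v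
  have : Nonempty (G.graph.Path u v) := ⟨w.toPath⟩
  obtain ⟨q, hq⟩ := Finite.exists_min fun q : G.graph.Path u v => G.walkLen q.1
  refine ⟨q.1, q.2, le_antisymm ?_ (dist_le_walkLen hpos _)⟩
  have : Nonempty (G.graph.Walk u v) := ⟨w⟩
  refine le_csInf (Set.range_nonempty _) ?_
  rintro _ ⟨p, rfl⟩
  exact (hq p.toPath).trans (walkLen_bypass_le hpos p)

theorem dist_nonneg (hpos : ∀ e ∈ G.graph.edgeSet, 0 < G.len e) (u v : V) : 0 ≤ G.dist u v :=
  Real.sInf_nonneg (by rintro _ ⟨p, rfl⟩; exact walkLen_nonneg hpos p)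

theorem dist_self (hpos : ∀ e ∈ G.graph.edgeSet, 0 < G.len e) (u : V) : G.dist u u = 0 :=
  le_antisymm ((dist_le_walkLen hpos (SimpleGraph.Walk.nil : G.graph.Walk u u)).trans
    (by simp [walkLen])) (dist_nonneg hpos u u)

theorem dist_triangle [Finite V] (hconn : G.graph.Connected)
    (hpos : ∀ e ∈ G.graph.edgeSet, 0 < G.len e) (u v w : V) :
    G.dist u w ≤ G.dist u v + G.dist v w := by
  obtain ⟨p, -, hp⟩ := exists_isShortestPath hconn hpos u v
  obtain ⟨q, -, hq⟩ := exists_isShortestPath hconn hpos v w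
  rw [← hp, ← hq, ← walkLen_append]
  exact dist_le_walkLen hpos _

theorem IsShortestPath.dist_add_dist [Finite V] (hconn : G.graph.Connected)
    (hpos : ∀ e ∈ G.graph.edgeSet, 0 < G.len e) {u v z : V} {p : G.graph.Walk u v}
    (hp : G.IsShortestPath p) (hz : z ∈ p.support) :
    G.dist u z + G.dist z v = G.dist u v := by
  classical
  refine le_antisymm ?_ (dist_triangle hconn hpos u z v)
  rw [← hp.2, ← p.take_spec hz, walkLen_append]
  exact add_le_add (dist_le_walkLen hpos _) (dist_le_walkLen hpos _)

/-- In a ball of radius `c * r` the highway dimension bounds the size of a hitting set. -/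
theorem exists_hittingSet [Finite V] (c : ℝ) {r : ℝ} (hr : 0 < r) (v : V) :
    ∃ K : Set V, K.ncard ≤ G.highwayDimension c ∧
      ∀ (x y : V) (p : G.graph.Walk x y), G.IsShortestPath p →
        (∀ z ∈ p.support, z ∈ G.ball v (c * r)) → r < G.walkLen p → ∃ h ∈ K, h ∈ p.support := by
  have hne : {k | ∀ r : ℝ, 0 < r → ∀ v : V, ∃ K : Set V, K ⊆ G.ball v (c * r) ∧ K.ncard ≤ k ∧
    ∀ (x y : V) (p : G.graph.Walk x y), G.IsShortestPath p →
      (∀ z ∈ p.support, z ∈ G.ball v (c * r)) → r < G.walkLen p →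
        ∃ h ∈ K, h ∈ p.support}.Nonempty :=
    -- The ball itself is a hitting set, so the infimum is attained and is not the default value of
    -- `sInf ∅`.
    ⟨Nat.card V, fun r _ v => ⟨G.ball v (c * r), subset_rfl, Set.ncard_le_card _,
      fun x y p _ h _ => ⟨x, h x p.start_mem_support, p.start_mem_support⟩⟩⟩
  obtain ⟨K, -, h⟩ := Nat.sInf_mem hne r hr v
  exact ⟨K, h⟩

theorem dist_le_diam [Finite V] {S : Set V} {u v : V} (hu : u ∈ S) (hv : v ∈ S) :
    G.dist u v ≤ G.diam S := by
  refine le_csSup ?_ ⟨u, hu, v, hv, rfl⟩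
  refine ((Set.finite_range fun p : V × V => G.dist p.1 p.2).subset ?_).bddAbove
  rintro _ ⟨u, -, v, -, rfl⟩
  exact ⟨(u, v), rfl⟩

theorem setDist_le_dist (hpos : ∀ e ∈ G.graph.edgeSet, 0 < G.len e) {S T : Set V} {u v : V}
    (hu : u ∈ S) (hv : v ∈ T) : G.setDist S T ≤ G.dist u v :=
  csInf_le ⟨0, by rintro _ ⟨u, -, v, -, rfl⟩; exact dist_nonneg hpos u v⟩ ⟨u, hu, v, hv, rfl⟩

theorem exists_dist_eq_setDist [Finite V] {S T : Set V} (hS : S.Nonempty) (hT : T.Nonempty) :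
    ∃ u ∈ S, ∃ v ∈ T, G.setDist S T = G.dist u v := by
  have hfin : {x | ∃ u ∈ S, ∃ v ∈ T, x = G.dist u v}.Finite := by
    refine (Set.finite_range fun p : V × V => G.dist p.1 p.2).subset ?_
    rintro _ ⟨u, -, v, -, rfl⟩
    exact ⟨(u, v), rfl⟩
  obtain ⟨u, hu⟩ := hS
  obtain ⟨v, hv⟩ := hT
  have hne : {x | ∃ u ∈ S, ∃ v ∈ T, x = G.dist u v}.Nonempty := ⟨_, u, hu, v, hv, rfl⟩
  exact hne.csInf_mem hfin

end WGraph

/-! ### The towns decomposition -/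

namespace Setup

variable {V : Type*}

/-- The standing assumptions on the input graph and on the shortest path covers. -/
structure Admissible (P : Setup V) (lam : ℝ) : Prop where
  conn : P.G.graph.Connected
  pos : ∀ e ∈ P.G.graph.edgeSet, 0 < P.G.len e
  c_eq : P.c = 4 + lam
  lam_pos : 0 < lam
  lam_le : lam ≤ 4
  scale : ∀ u v : V, u ≠ v → P.c / 2 < P.G.dist u v
  minimal : ∀ i : ℕ, Minimal (P.G.IsSPC P.c (P.r i)) (P.spc i)
  ε_pos : 0 < P.ε
  ε_le : P.ε ≤ 1

namespace Admissible

variable {P : Setup V} {lam : ℝ} (hP : P.Admissible lam)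

include hP

theorem dist_self (u : V) : P.G.dist u u = 0 := WGraph.dist_self hP.pos u

theorem dist_nonneg (u v : V) : 0 ≤ P.G.dist u v := WGraph.dist_nonneg hP.pos u v

theorem dist_triangle [Finite V] (u v w : V) : P.G.dist u w ≤ P.G.dist u v + P.G.dist v w :=
  WGraph.dist_triangle hP.conn hP.pos u v w

theorem four_lt_c : 4 < P.c := by linarith [hP.c_eq, hP.lam_pos]

theorem c_le : P.c ≤ 8 := by linarith [hP.c_eq, hP.lam_le]

theorem two_lt_dist {u v : V} (h : u ≠ v) : 2 < P.G.dist u v := by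
  linarith [hP.scale u v h, hP.four_lt_c]

theorem eq_of_dist_le {u v : V} (h : P.G.dist u v ≤ 2) : u = v := by
  by_contra hne
  exact absurd h (not_le.2 (hP.two_lt_dist hne))

theorem r_pos (i : ℕ) : 0 < P.r i := pow_pos (by linarith [hP.four_lt_c]) i

theorem r_mono {i j : ℕ} (h : i ≤ j) : P.r i ≤ P.r j :=
  pow_le_pow_right₀ (by linarith [hP.four_lt_c]) h

omit hP in
theorem r_zero : P.r 0 = 1 := pow_zero _

omit hP in
theorem r_succ (i : ℕ) : P.r (i + 1) = P.c / 4 * P.r i := pow_succ' _ _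

omit hP in
theorem r_add (i j : ℕ) : P.r (i + j) = P.r i * (P.c / 4) ^ j := pow_add _ _ _

theorem r_succ_le (i : ℕ) : P.r (i + 1) ≤ 2 * P.r i := by
  rw [r_succ]
  exact mul_le_mul_of_nonneg_right (by linarith [hP.c_le]) (hP.r_pos i).le

theorem exists_le_r (x : ℝ) : ∃ i, x ≤ P.r i := by
  obtain ⟨n, hn⟩ := pow_unbounded_of_one_lt x (show 1 < P.c / 4 by linarith [hP.four_lt_c])
  exact ⟨n, hn.le⟩

theorem exists_scale {x : ℝ} (hx : 2 < x) : ∃ l, x ≤ P.r (l + 1) ∧ P.r l < x := by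
  classical
  have hex : ∃ i, x ≤ P.r (i + 1) := by
    obtain ⟨i, hi⟩ := hP.exists_le_r x
    exact ⟨i, hi.trans (hP.r_mono i.le_succ)⟩
  refine ⟨Nat.find hex, Nat.find_spec hex, ?_⟩
  rcases hn : Nat.find hex with _ | m
  · rw [r_zero]
    linarith
  · exact not_le.1 (Nat.find_min hex (m := m) (by omega))

theorem exists_hub [Finite V] {i : ℕ} {x y : V} (h1 : P.r i < P.G.dist x y)
    (h2 : P.G.dist x y ≤ P.c * P.r i / 2) :
    ∃ h ∈ P.spc i, P.G.dist x h + P.G.dist h y = P.G.dist x y := by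
  obtain ⟨p, hp⟩ := WGraph.exists_isShortestPath hP.conn hP.pos x y
  obtain ⟨h, hh, hs⟩ := (hP.minimal i).prop x y p hp (hp.2 ▸ h1) (hp.2 ▸ h2)
  exact ⟨h, hh, hp.dist_add_dist hP.conn hP.pos hs⟩

/-- By minimality some path is no longer hit once `h` is removed from the cover, so `h` lies on it.
-/
theorem exists_path_of_mem_spc {i : ℕ} {h : V} (hh : h ∈ P.spc i) :
    ∃ (x y : V) (p : P.G.graph.Walk x y), P.G.IsShortestPath p ∧ h ∈ p.support ∧
      P.r i < P.G.walkLen p ∧ P.G.walkLen p ≤ P.c * P.r i / 2 := by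
  have hnot : ¬ P.G.IsSPC P.c (P.r i) (P.spc i \ {h}) := fun hs =>
    (((hP.minimal i).le_of_le hs Set.sdiff_subset) hh).2 rfl
  unfold WGraph.IsSPC at hnot
  push Not at hnot
  obtain ⟨x, y, p, hp, h1, h2, hno⟩ := hnot
  obtain ⟨h', hh', hs⟩ := (hP.minimal i).prop x y p hp h1 h2
  refine ⟨x, y, p, hp, ?_, h1, h2⟩
  by_cases he : h' = h
  · exact he ▸ hs
  · exact absurd hs (hno h' ⟨hh', he⟩)

/-- No distance lies in `(1, c / 2]`, so there is nothing to hit and minimality leaves no hub. This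
is what makes all singletons towns on level `0`. -/
theorem spc_zero [Finite V] : P.spc 0 = ∅ := by
  refine Set.eq_empty_of_forall_notMem fun h hh => ?_
  obtain ⟨x, y, p, hp, -, h1, h2⟩ := hP.exists_path_of_mem_spc hh
  rw [hp.2, r_zero] at h1 h2
  have hne : x ≠ y := by
    rintro rfl
    rw [hP.dist_self] at h1
    linarith
  linarith [hP.scale x y hne]

theorem isTownOn_zero_singleton [Finite V] (v : V) : P.IsTownOn 0 {v} := by
  refine ⟨v, by simp [hP.spc_zero], ?_⟩
  ext u
  simp only [Set.mem_singleton_iff, WGraph.ball, Set.mem_ofPred_eq, r_zero]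
  constructor
  · rintro rfl
    rw [hP.dist_self]
    norm_num
  · intro h
    exact hP.eq_of_dist_le (by linarith)

theorem isTownOn_univ [Finite V] {i : ℕ} (h : ∀ u v, P.G.dist u v ≤ P.r i) :
    P.IsTownOn i Set.univ := by
  have : P.spc i = ∅ := by
    refine Set.eq_empty_of_forall_notMem fun z hz => ?_
    obtain ⟨x, y, p, hp, -, h1, -⟩ := hP.exists_path_of_mem_spc hz
    rw [hp.2] at h1
    exact absurd (h x y) (not_le.2 h1)
  obtain ⟨v⟩ := hP.conn.nonempty
  exact ⟨v, by simp [this], (Set.eq_univ_of_forall fun u => h u v).symm⟩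

theorem nonempty_of_isTownOn {i : ℕ} {T : Set V} (hT : P.IsTownOn i T) : T.Nonempty := by
  obtain ⟨v, -, rfl⟩ := hT
  refine ⟨v, ?_⟩
  simpa [WGraph.ball, hP.dist_self] using (hP.r_pos i).le

/-- Otherwise the distance is in `(r i, 2 * r i]` and a hub lies on a shortest path from `u` to `w`.
Averaging the routes to it from the centre via `u` and via `w` puts it within `2 * r i` of the
centre. -/
theorem dist_le_of_isTownOn [Finite V] {i : ℕ} {T : Set V} (hT : P.IsTownOn i T) {u w : V}
    (hu : u ∈ T) (hw : w ∈ T) : P.G.dist u w ≤ P.r i := by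
  obtain ⟨v, hv, rfl⟩ := hT
  by_contra hlt
  simp only [WGraph.ball, Set.mem_ofPred_eq] at hu hw
  have h0 := hP.r_pos i
  have h1 := hP.dist_triangle u v w
  have h2 := P.G.dist_comm v w
  obtain ⟨h, hh, hd⟩ := hP.exists_hub (not_le.1 hlt) (by nlinarith [hP.four_lt_c])
  have h3 := hv h hh
  have h4 := hP.dist_triangle v u h
  have h5 := hP.dist_triangle v w h
  have h6 := P.G.dist_comm v u
  have h7 := P.G.dist_comm w h
  linarith

/-- If `w` were that close, it would be at distance in `(r i, 2 * r i]` from the centre, and the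
path from the centre to `w` would contain a forbidden hub. -/
theorem lt_dist_of_isTownOn [Finite V] {i : ℕ} {T : Set V} (hT : P.IsTownOn i T) {u w : V}
    (hu : u ∈ T) (hw : w ∉ T) : P.r i < P.G.dist u w := by
  obtain ⟨v, hv, rfl⟩ := hT
  by_contra hle
  simp only [WGraph.ball, Set.mem_ofPred_eq, not_le] at hu hw hle
  rw [P.G.dist_comm] at hw
  have h0 := hP.r_pos i
  have h1 := hP.dist_triangle v u w
  have h2 := P.G.dist_comm v u
  obtain ⟨h, hh, hd⟩ := hP.exists_hub hw (by nlinarith [hP.four_lt_c])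
  have h3 := hv h hh
  have h4 := hP.dist_nonneg h w
  linarith

theorem subset_of_isTownOn [Finite V] {i l : ℕ} {T B : Set V} (hT : P.IsTownOn i T)
    (hB : P.IsTownOn l B) (hl : l ≤ i) {x : V} (hxT : x ∈ T) (hxB : x ∈ B) : B ⊆ T := by
  intro y hy
  by_contra hyT
  have h1 := hP.lt_dist_of_isTownOn hT hxT hyT
  have h2 := hP.dist_le_of_isTownOn hB hxB hy
  linarith [hP.r_mono hl]

omit hP in
theorem isTownOn_level {T : Set V} (hT : P.IsTown T) : P.IsTownOn (P.level T) T :=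
  Nat.sInf_mem (s := {i | P.IsTownOn i T}) hT

omit hP in
theorem level_le {i : ℕ} {T : Set V} (hT : P.IsTownOn i T) : P.level T ≤ i := Nat.sInf_le hT

theorem nonempty_of_isTown {T : Set V} (hT : P.IsTown T) : T.Nonempty :=
  hP.nonempty_of_isTownOn (isTownOn_level hT)

theorem subset_or_subset [Finite V] {T B : Set V} (hT : P.IsTown T) (hB : P.IsTown B) {x : V}
    (hxT : x ∈ T) (hxB : x ∈ B) : B ⊆ T ∨ T ⊆ B := by
  obtain ⟨i, hT⟩ := hT
  obtain ⟨l, hB⟩ := hB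
  rcases le_total l i with h | h
  · exact Or.inl (hP.subset_of_isTownOn hT hB h hxT hxB)
  · exact Or.inr (hP.subset_of_isTownOn hB hT h hxB hxT)

theorem level_lt_of_ssubset [Finite V] {T B : Set V} (hT : P.IsTown T) (hB : P.IsTown B)
    (h : B ⊂ T) : P.level B < P.level T := by
  by_contra hle
  obtain ⟨x, hx⟩ := hP.nonempty_of_isTown hB
  exact h.2 (hP.subset_of_isTownOn (isTownOn_level hB) (isTownOn_level hT) (not_lt.1 hle) hx
    (h.1 hx))

theorem level_lt [Finite V] {A T : Set V} (h : P.IsChild A T) : P.level A < P.level T :=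
  hP.level_lt_of_ssubset h.2.1 h.1 h.2.2.1

theorem level_ne_zero [Finite V] {A T : Set V} (h : P.IsChild A T) : P.level T ≠ 0 :=
  (Nat.zero_le _).trans_lt (hP.level_lt h) |>.ne'

theorem child_unique [Finite V] {A B T : Set V} (hA : P.IsChild A T) (hB : P.IsChild B T) {x : V}
    (hxA : x ∈ A) (hxB : x ∈ B) : A = B := by
  by_contra hne
  rcases hP.subset_or_subset hA.1 hB.1 hxA hxB with h | h
  · exact hB.2.2.2 A hA.1 (h.ssubset_of_ne (Ne.symm hne)) hA.2.2.1
  · exact hA.2.2.2 B hB.1 (h.ssubset_of_ne hne) hB.2.2.1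

theorem isTown_singleton [Finite V] (v : V) : P.IsTown {v} := ⟨0, hP.isTownOn_zero_singleton v⟩

theorem level_singleton [Finite V] (v : V) : P.level {v} = 0 :=
  Nat.le_zero.1 (level_le (hP.isTownOn_zero_singleton v))

theorem exists_eq_singleton [Finite V] {T : Set V} (hT : P.IsTown T) (h : P.level T = 0) :
    ∃ v, T = {v} := by
  obtain ⟨v, hv⟩ := hP.nonempty_of_isTown hT
  refine ⟨v, Set.eq_singleton_iff_unique_mem.2 ⟨hv, fun u hu => hP.eq_of_dist_le ?_⟩⟩
  have := hP.dist_le_of_isTownOn (isTownOn_level hT) hu hv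
  rw [h, r_zero] at this
  linarith

omit hP in
/-- A town that is properly contained in `T` is contained in a child town of `T`. -/
theorem exists_child_superset [Finite V] {T B : Set V} (hT : P.IsTown T) (hB : P.IsTown B)
    (h : B ⊂ T) : ∃ A, P.IsChild A T ∧ B ⊆ A := by
  obtain ⟨A, hBA, hA⟩ := (Set.toFinite {A | P.IsTown A ∧ A ⊂ T}).exists_le_maximal ⟨hB, h⟩
  refine ⟨A, ⟨hA.prop.1, hT, hA.prop.2, fun B hB hAB hBT => ?_⟩, hBA⟩
  exact hAB.2 (hA.le_of_ge ⟨hB, hBT⟩ hAB.1)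

theorem exists_child [Finite V] {T : Set V} (hT : P.IsTown T) (h : P.level T ≠ 0) {x : V}
    (hx : x ∈ T) : ∃ A, P.IsChild A T ∧ x ∈ A := by
  have hss : {x} ⊂ T := by
    refine (Set.singleton_subset_iff.2 hx).ssubset_of_ne ?_
    rintro rfl
    exact h (hP.level_singleton x)
  obtain ⟨A, hA, hxA⟩ := exists_child_superset hT (hP.isTown_singleton x) hss
  exact ⟨A, hA, hxA rfl⟩

/-- Induction over the towns decomposition. -/
theorem town_induction [Finite V] {motive : (T : Set V) → P.IsTown T → Prop}
    (h : ∀ T hT, (∀ A (hA : P.IsChild A T), motive A hA.1) → motive T hT) {T : Set V}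
    (hT : P.IsTown T) : motive T hT := by
  suffices ∀ n, ∀ T (hT : P.IsTown T), P.level T = n → motive T hT from this _ T hT rfl
  intro n
  induction n using Nat.strong_induction_on with
  | _ n ih =>
    rintro T hT rfl
    exact h T hT fun A hA => ih _ (hP.level_lt hA) A hA.1 rfl

theorem spc_subset_sprawl [Finite V] (l : ℕ) : P.spc l ⊆ P.sprawl l := by
  rintro h hh T ⟨v, hv, rfl⟩ hT
  simp only [WGraph.ball, Set.mem_ofPred_eq] at hT
  rw [P.G.dist_comm] at hT
  linarith [hv h hh, hP.r_pos l]

/-- A vertex of the sprawl is close to a hub. -/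
theorem exists_hub_of_mem_sprawl {l : ℕ} {u : V} (hu : u ∈ P.sprawl l) :
    ∃ h ∈ P.spc l, P.G.dist u h ≤ 2 * P.r l := by
  by_contra hno
  push Not at hno
  refine hu _ ⟨u, hno, rfl⟩ ?_
  simpa [WGraph.ball, hP.dist_self] using (hP.r_pos l).le

/-- Every town of positive level has a core hub. -/
theorem exists_coreHub [Finite V] {T : Set V} (hT : P.IsTown T) (h0 : P.level T ≠ 0) :
    ∃ l, 1 ≤ l ∧ l < P.level T ∧ (P.core T l ∩ P.spc l).Nonempty := by
  obtain ⟨x, hx⟩ := hP.nonempty_of_isTown hT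
  obtain ⟨A, hA, hxA⟩ := hP.exists_child hT h0 hx
  obtain ⟨y, hy, hyA⟩ := Set.exists_of_ssubset hA.2.2.1
  -- a closest pair of vertices in different child towns
  let S : Set (V × V) := {p | p.1 ∈ T ∧ p.2 ∈ T ∧ ∀ B, P.IsChild B T → p.1 ∈ B → p.2 ∉ B}
  have hxy : (x, y) ∈ S := ⟨hx, hy, fun B hB hxB => hP.child_unique hA hB hxA hxB ▸ hyA⟩
  obtain ⟨⟨u, w⟩, ⟨huT, hwT, huw⟩, hmin⟩ :=
    Set.exists_min_image S (fun p => P.G.dist p.1 p.2) (Set.toFinite S) ⟨_, hxy⟩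
  simp only at huT hwT huw hmin
  have hne : u ≠ w := by
    rintro rfl
    obtain ⟨B, hB, huB⟩ := hP.exists_child hT h0 huT
    exact huw B hB huB huB
  have hle := hP.dist_le_of_isTownOn (isTownOn_level hT) huT hwT
  obtain ⟨l, hl, hlt⟩ := hP.exists_scale (hP.two_lt_dist hne)
  have hl1 : 1 ≤ l := by
    rcases Nat.eq_zero_or_pos l with rfl | h
    · rw [r_succ, r_zero] at hl
      linarith [hP.two_lt_dist hne, hP.c_le]
    · exact h
  have hlj : l < P.level T := by
    by_contra hge
    linarith [hP.r_mono (not_lt.1 hge)]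
  have hr := hP.r_pos l
  obtain ⟨h, hh, hd⟩ := hP.exists_hub hlt (by rw [r_succ] at hl; nlinarith [hP.four_lt_c])
  have hsymm : ∀ p q, (p, q) ∈ S → (q, p) ∈ S := fun p q hpq =>
    ⟨hpq.2.1, hpq.1, fun B hB hqB hpB => hpq.2.2 B hB hpB hqB⟩
  -- Leaving `T` costs more than `r (level T)`, while `h` is at most as far from `u` as `w` is.
  have hhT : h ∈ T := by
    by_contra hhT
    have := hP.lt_dist_of_isTownOn (isTownOn_level hT) huT hhT
    linarith [hP.dist_nonneg h w]
  refine ⟨l, hl1, hlj, h, ⟨hhT, fun l' hl' hl'j B hB hhB => ?_⟩, hh⟩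
  have hBT : B ⊂ T := by
    refine (hP.subset_of_isTownOn (isTownOn_level hT) hB hl'j.le hhT hhB).ssubset_of_ne ?_
    rintro rfl
    exact absurd (level_le hB) (not_le.2 hl'j)
  obtain ⟨D, hD, hBD⟩ := exists_child_superset hT ⟨l', hB⟩ hBT
  -- Minimality of the pair forces `a = h`. Then `B` contains `a` but not `b`, so `r l' < dist a b ≤
  -- r (l + 1)`. This leaves `l' = l`, but a hub lies in no town of its own level.
  have key : ∀ a b, (a, b) ∈ S → P.G.dist a b = P.G.dist u w → a ∈ D →
      P.G.dist a h + P.G.dist h b = P.G.dist a b → False := by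
    intro a b hab hdab haD hdist
    have hhb : P.G.dist a b ≤ P.G.dist h b := by
      rw [hdab]
      refine hmin (h, b) ⟨hhT, hab.2.1, fun E hE hhE hbE => ?_⟩
      rw [hP.child_unique hE hD hhE (hBD hhB)] at hbE
      exact hab.2.2 D hD haD hbE
    have hah : a = h := hP.eq_of_dist_le (by linarith)
    subst hah
    have hbB : b ∉ B := fun hbB => hab.2.2 D hD haD (hBD hbB)
    have hlt' := hP.lt_dist_of_isTownOn hB hhB hbB
    rcases hl'.eq_or_lt with rfl | hlt2
    · exact hP.spc_subset_sprawl _ hh B hB hhB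
    · linarith [hP.r_mono (show l + 1 ≤ l' from hlt2)]
  by_cases huD : u ∈ D
  · exact key u w ⟨huT, hwT, huw⟩ rfl huD hd
  by_cases hwD : w ∈ D
  · refine key w u (hsymm u w ⟨huT, hwT, huw⟩) (P.G.dist_comm w u) hwD ?_
    rw [P.G.dist_comm w h, P.G.dist_comm h u, P.G.dist_comm w u]
    linarith
  -- With both ends outside `D`, the vertices `u` and `h` form a competing pair, which forces `h =
  -- w`.
  · have h1 : P.G.dist u w ≤ P.G.dist u h := hmin (u, h)
      ⟨huT, hhT, fun E hE huE hhE => huD (hP.child_unique hE hD hhE (hBD hhB) ▸ huE)⟩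
    have h2 : h = w := hP.eq_of_dist_le (by linarith)
    exact hwD (h2 ▸ hBD hhB)

end Admissible

end Setup

/-! ### Rooted trees -/

section RootedTree

variable {ι : Type*} {par : ι → ι → Prop} {root : ι}

/-- A parent relation whose nodes all lead to the root describes a tree. -/
theorem isTree_fromRel [Finite ι] (huniq : ∀ m n n', par m n → par m n' → n = n')
    (hroot : ∀ n, ¬ par root n) (hreach : ∀ m, Relation.ReflTransGen par m root) :
    (SimpleGraph.fromRel par).IsTree := by
  classical
  have hconn : (SimpleGraph.fromRel par).Connected := by
    have h : ∀ m, (SimpleGraph.fromRel par).Reachable m root := by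
      intro m
      induction hreach m using Relation.ReflTransGen.head_induction_on with
      | refl => rfl
      | @head a b hab _ ih =>
        by_cases hne : a = b
        · exact hne ▸ ih
        · exact (SimpleGraph.Adj.reachable (by simp [hne, hab])).trans ih
    have : Nonempty ι := ⟨root⟩
    exact ⟨fun m n => (h m).trans (h n).symm⟩
  -- Each edge joins a node other than the root to its parent, so there are fewer edges than nodes.
  refine SimpleGraph.isTree_iff_connected_and_card.2 ⟨hconn,
    le_antisymm ?_ hconn.card_vert_le_card_edgeSet_add_one⟩
  have hex : ∀ m, m ≠ root → ∃ n, par m n := by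
    intro m hm
    rcases Relation.ReflTransGen.cases_head (hreach m) with h | ⟨n, hn, -⟩
    · exact absurd h hm
    · exact ⟨n, hn⟩
  choose! p hp using hex
  have hsub : (SimpleGraph.fromRel par).edgeSet ⊆
      (fun m => s(m, p m)) '' ({root}ᶜ : Set ι) := by
    have key : ∀ m n, par m n → s(m, n) ∈ (fun m => s(m, p m)) '' ({root}ᶜ : Set ι) := by
      intro m n hmn
      have hm : m ≠ root := by
        rintro rfl
        exact hroot n hmn
      exact ⟨m, hm, by rw [huniq m n (p m) hmn (hp m hm)]⟩
    intro e he
    induction e using Sym2.ind with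
    | _ m n =>
      rw [SimpleGraph.mem_edgeSet, SimpleGraph.fromRel_adj] at he
      rcases he.2 with h | h
      · exact key m n h
      · rw [Sym2.eq_swap]
        exact key n m h
  have h1 : Nat.card (SimpleGraph.fromRel par).edgeSet ≤ ({root}ᶜ : Set ι).ncard :=
    (Set.ncard_le_ncard hsub (Set.toFinite _)).trans (Set.ncard_image_le (Set.toFinite _))
  have h2 := Set.ncard_add_ncard_compl ({root} : Set ι)
  rw [Set.ncard_singleton] at h2
  omega

/-- A set of nodes is connected if each of its nodes except one has its parent in the set. -/
theorem connected_induce_fromRel (huniq : ∀ m n n', par m n → par m n' → n = n')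
    (hroot : ∀ n, ¬ par root n) (hreach : ∀ m, Relation.ReflTransGen par m root)
    {S : Set ι} {t : ι} (ht : t ∈ S) (hS : ∀ n ∈ S, n ≠ t → ∃ p ∈ S, par n p) :
    ((SimpleGraph.fromRel par).induce S).Connected := by
  have key : ∀ m (hm : m ∈ S),
      ((SimpleGraph.fromRel par).induce S).Reachable ⟨m, hm⟩ ⟨t, ht⟩ := by
    intro m
    induction hreach m using Relation.ReflTransGen.head_induction_on with
    | refl =>
      intro hm
      by_cases h : root = t
      · subst h
        rfl
      · obtain ⟨p, -, hp⟩ := hS root hm h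
        exact absurd hp (hroot p)
    | @head a b hab _ ih =>
      intro ha
      by_cases h : a = t
      · subst h
        rfl
      · obtain ⟨p, hpS, hp⟩ := hS a ha h
        obtain rfl := huniq a b p hab hp
        by_cases hne : a = b
        · subst hne
          exact ih ha
        · exact (SimpleGraph.Adj.reachable (by simp [hne, hab])).trans (ih hpS)
  have : Nonempty S := ⟨⟨t, ht⟩⟩
  exact ⟨fun m n => (key m.1 m.2).trans (key n.1 n.2).symm⟩

end RootedTree

namespace Choices

variable {V : Type*} {R : Choices V} {P : Setup V} {T : Set V}

/-! ### The shape of the choices for a town -/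

namespace ValidAt

variable (hR : R.ValidAt P T)

include hR

/-- A hub that moves lands on an approximate core hub of a lower level, so by induction only hubs
that stay put matter, and these lie in the core. -/
theorem X_subset : R.X P T ⊆ T := by
  rintro x ⟨i, h1, hi, hx⟩
  induction i using Nat.strong_induction_on generalizing x with
  | _ i ih =>
    obtain ⟨h, hh, rfl⟩ := hx
    by_cases hex : ∃ l, 1 ≤ l ∧ l < i ∧ ∃ h' ∈ R.XLevel P T l, P.G.dist h h' ≤ P.ε * P.r i
    · obtain ⟨⟨l, hl, hli, hmem⟩, -⟩ := hR.shift_lower i h1 hi h hh hex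
      exact ih l hli hl (hli.trans hi) hmem
    · rw [hR.shift_self i h1 hi h hh hex]
      exact hh.1.1

theorem Y_subset_X : R.Y P T ⊆ R.X P T := by
  rintro _ ⟨x, hx, rfl⟩
  exact hR.rep_mem x hx

theorem exists_child_of_mem_X {lam : ℝ} [Finite V] (hP : P.Admissible lam) (hT : P.IsTown T)
    {x : V} (hx : x ∈ R.X P T) : ∃ A, P.IsChild A T ∧ x ∈ A := by
  have h0 : P.level T ≠ 0 := by
    obtain ⟨i, h1, hi, -⟩ := hx
    omega
  exact hP.exists_child hT h0 (hR.X_subset hx)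

omit hR in
theorem rep_mem_Y {x : V} (hx : x ∈ R.X P T) : R.rep T x ∈ R.Y P T := ⟨x, hx, rfl⟩

theorem cl_subset_cl {i l : ℕ} (hil : i ≤ l) (hl : l ≤ R.top P T) {y : V} (hy : y ∈ R.Y P T) :
    R.cl T i y ⊆ R.cl T l y := by
  induction l, hil using Nat.le_induction with
  | base => rfl
  | succ l hil ih =>
    exact (ih (by omega)).trans (hR.splitTree.refine_succ l (by omega) y hy)

theorem mem_cl {i : ℕ} (hi : i ≤ R.top P T) {y : V} (hy : y ∈ R.Y P T) : y ∈ R.cl T i y :=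
  hR.splitTree.self_mem i hi y hy

theorem cl_eq {i : ℕ} (hi : i ≤ R.top P T) {y z : V} (hy : y ∈ R.Y P T) (hz : z ∈ R.cl T i y) :
    R.cl T i z = R.cl T i y :=
  hR.splitTree.partition i hi y hy z hz

theorem mem_Y_of_mem_cl {i : ℕ} (hi : i ≤ R.top P T) {y z : V} (hy : y ∈ R.Y P T)
    (hz : z ∈ R.cl T i y) : z ∈ R.Y P T :=
  hR.splitTree.subset i hi y hy hz

theorem mem_net_zero {y : V} (hy : y ∈ R.Y P T) : y ∈ R.net T 0 (R.cl T 0 y) := by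
  obtain ⟨h1, h2, -⟩ := hR.isNet 0 (Nat.zero_le _) y hy
  obtain ⟨v, hv, -⟩ := h2 y (hR.mem_cl (Nat.zero_le _) hy)
  have h3 := h1 hv
  rw [hR.splitTree.lowest y hy, Set.mem_singleton_iff] at h3
  exact h3 ▸ hv

/-- The levels at which a representative is in the net of its cluster are downward closed. -/
theorem mem_net_of_mem_net_succ {i : ℕ} (hi : i < R.top P T) {y : V} (hy : y ∈ R.Y P T)
    (h : y ∈ R.net T (i + 1) (R.cl T (i + 1) y)) : y ∈ R.net T i (R.cl T i y) := by
  obtain ⟨z, hz, hyz⟩ := hR.hierarchy i hi y hy y h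
  have hzY := hR.mem_Y_of_mem_cl (by omega) hy hz
  have := (hR.isNet i hi.le z hzY).1 hyz
  rwa [hR.cl_eq hi.le hzY this]

theorem rep_hub_mem_Y {A : Set V} (hA : P.IsChild A T) : R.rep T (R.hub T A) ∈ R.Y P T :=
  rep_mem_Y (hR.hub_mem A hA)

omit hR in
theorem connLevel_le (A : Set V) : R.connLevel P T A ≤ R.top P T := min_le_left _ _

theorem isCoreName_conn {lam : ℝ} [Finite V] (hP : P.Admissible lam) {A : Set V}
    (hA : P.IsChild A T) : R.IsCoreName P T (R.connLevel P T A) (R.connCluster P T A) :=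
  ⟨hP.level_ne_zero hA, connLevel_le A, _, hR.rep_hub_mem_Y hA, rfl⟩

/-- If the child town `A` contains an approximate core hub, then the hub of `A` is one of them. -/
theorem rep_hub_eq {lam : ℝ} [Finite V] (hP : P.Admissible lam) {A : Set V}
    (hA : P.IsChild A T) {x : V} (hx : x ∈ R.X P T ∩ A) : R.rep T (R.hub T A) = R.rep T x := by
  obtain ⟨u, hu, w, hw, hd⟩ :=
    WGraph.exists_dist_eq_setDist (G := P.G) ⟨x, hx.2⟩ (Set.singleton_nonempty (R.hub T A))
  rw [Set.mem_singleton_iff] at hw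
  subst hw
  have h1 := hR.hub_closest A hA x hx.1
  have h2 := WGraph.setDist_le_dist hP.pos hx.2 (Set.mem_singleton x)
  rw [hP.dist_self] at h2
  -- The town contains a hub, so its distance to the closest hub is zero.
  have : u = R.hub T A := hP.eq_of_dist_le (by linarith)
  exact hR.rep_eq A hA _ (hR.hub_mem A hA) _ hx.1 (this ▸ hu) hx.2

/-- Membership below the connecting bag depends only on the ancestor cluster on its level. In this
form the condition passes to the parent cluster. -/
theorem cl_subset_connCluster_iff {A : Set V}
    (hA : P.IsChild A T) {i : ℕ} {y : V} (hi : i ≤ R.connLevel P T A)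
    (hy : y ∈ R.Y P T) :
    R.cl T i y ⊆ R.connCluster P T A ↔ R.cl T (R.connLevel P T A) y = R.connCluster P T A := by
  constructor
  · intro h
    exact hR.cl_eq (connLevel_le A) (hR.rep_hub_mem_Y hA)
      (h (hR.mem_cl (hi.trans (connLevel_le A)) hy))
  · intro h
    rw [← h]
    exact hR.cl_subset_cl hi (connLevel_le A) hy

end ValidAt

end Choices

namespace Choices

variable {V : Type*} {R : Choices V} {P : Setup V} {T : Set V}

/-! ### The names of the bags -/

variable {lam : ℝ} [Finite V] (hP : P.Admissible lam)

include hP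

theorem X_nonempty (hT : P.IsTown T) (h0 : P.level T ≠ 0) : (R.X P T).Nonempty := by
  obtain ⟨l, h1, h2, h, hh⟩ := hP.exists_coreHub hT h0
  exact ⟨_, l, h1, h2, h, hh, rfl⟩

theorem Valid.validAt (hR : R.Valid P) {A : Set V} (hA : P.IsChild A T) : R.ValidAt P T :=
  hR T hA.2.1 (hP.level_ne_zero hA)

theorem isName_rootName (hR : R.Valid P) (hT : P.IsTown T) : R.IsName P T (R.rootName P T) := by
  unfold rootName
  split_ifs with h
  · exact .single h
  · obtain ⟨x, hx⟩ := X_nonempty (R := R) hP hT h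
    have hy : R.rep T x ∈ R.Y P T := ⟨x, hx, rfl⟩
    exact .core ⟨h, le_rfl, _, hy, ((hR T hT h).splitTree.highest _ hy).symm⟩

omit [Finite V] in
theorem IsName.subset_nonempty (hT : P.IsTown T) {n : BagName V} (hn : R.IsName P T n) :
    n.1 ⊆ T ∧ n.1.Nonempty := by
  induction hn with
  | single h => exact ⟨subset_rfl, hP.nonempty_of_isTown hT⟩
  | core h => exact ⟨subset_rfl, hP.nonempty_of_isTown hT⟩
  | child hA _ ih => exact ⟨(ih hA.1).1.trans hA.2.2.1.1, (ih hA.1).2⟩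

/-- A name records the town that created the bag, a nonempty subset of the child town; different
child towns are disjoint. -/
theorem child_eq_of_isName {A B : Set V} (hA : P.IsChild A T) (hB : P.IsChild B T)
    {n : BagName V} (hnA : R.IsName P A n) (hnB : R.IsName P B n) : A = B := by
  obtain ⟨x, hx⟩ := (hnA.subset_nonempty hP hA.1).2
  exact hP.child_unique hA hB ((hnA.subset_nonempty hP hA.1).1 hx)
    ((hnB.subset_nonempty hP hB.1).1 hx)

omit [Finite V] in
theorem not_isName_of_isChild {A : Set V} (hA : P.IsChild A T) {n : BagName V}
    (hn : R.IsName P A n) : n.1 ≠ T := by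
  intro h
  have := (hn.subset_nonempty hP hA.1).1
  rw [h] at this
  exact hA.2.2.1.2 this

omit [Finite V] hP in
theorem IsName.cases_of_level_ne_zero {n : BagName V} (hn : R.IsName P T n)
    (h0 : P.level T ≠ 0) : (∃ i C, n = (T, i, C) ∧ R.IsCoreName P T i C) ∨
      ∃ A, P.IsChild A T ∧ R.IsName P A n := by
  cases hn with
  | single h => exact absurd h h0
  | core h => exact Or.inl ⟨_, _, rfl, h⟩
  | child hA h => exact Or.inr ⟨_, hA, h⟩

theorem IsName.eq_of_level_eq_zero {n : BagName V} (hn : R.IsName P T n)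
    (h0 : P.level T = 0) : n = (T, 0, T) := by
  cases hn with
  | single h => rfl
  | core h => exact absurd h0 h.1
  | child hA h => exact absurd h0 (hP.level_ne_zero hA)

/-! ### The parents of the bags -/

theorem IsParent.isName (hR : R.Valid P) {m n : BagName V} (h : R.IsParent P T m n) :
    R.IsName P T m ∧ R.IsName P T n := by
  induction h with
  | core h0 hi hy =>
    exact ⟨.core ⟨h0, hi.le, _, hy, rfl⟩, .core ⟨h0, hi, _, hy, rfl⟩⟩
  | child hA _ ih => exact ⟨.child hA ih.1, .child hA ih.2⟩
  | join hA =>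
    exact ⟨.child hA (isName_rootName hP hR hA.1),
      .core ((hR.validAt hP hA).isCoreName_conn hP hA)⟩

theorem IsParent.of_core (hR : R.Valid P) {i : ℕ} {C : Set V} {n : BagName V}
    (h : R.IsParent P T (T, i, C) n) : i < R.top P T ∧
      ∃ y ∈ R.Y P T, C = R.cl T i y ∧ n = (T, i + 1, R.cl T (i + 1) y) := by
  generalize hm : (T, i, C) = m at h
  cases h with
  | core h0 hi hy =>
    simp only [Prod.mk.injEq, true_and] at hm
    obtain ⟨rfl, rfl⟩ := hm
    exact ⟨hi, _, hy, rfl, rfl⟩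
  | child hA h =>
    subst hm
    exact absurd rfl (not_isName_of_isChild hP hA (h.isName hP hR).1)
  | join hA =>
    exact absurd (hm ▸ rfl) (not_isName_of_isChild hP hA (isName_rootName hP hR hA.1))

theorem IsParent.of_child (hR : R.Valid P) {A : Set V} (hA : P.IsChild A T) {m n : BagName V}
    (hm : R.IsName P A m) (h : R.IsParent P T m n) : R.IsParent P A m n ∨
      m = R.rootName P A ∧ n = (T, R.connLevel P T A, R.connCluster P T A) := by
  cases h with
  | core h0 hi hy => exact absurd rfl (not_isName_of_isChild hP hA hm)
  | child hB h =>
    obtain rfl := child_eq_of_isName hP hA hB hm (h.isName hP hR).1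
    exact Or.inl h
  | join hB =>
    obtain rfl := child_eq_of_isName hP hA hB hm (isName_rootName hP hR hB.1)
    exact Or.inr ⟨rfl, rfl⟩

theorem not_isParent_rootName (hR : R.Valid P) (n : BagName V) :
    ¬ R.IsParent P T (R.rootName P T) n := by
  intro h
  unfold rootName at h
  split_ifs at h with h0
  · obtain ⟨-, y, hy, -⟩ := h.of_core hP hR
    obtain ⟨x, ⟨i, h1, hi, -⟩, -⟩ := hy
    omega
  · exact absurd (h.of_core hP hR).1 (lt_irrefl _)

/-- A cluster lies in only one cluster of the next level. The root of a child decomposition has no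
parent inside it, so the edge to the connecting bag has no competitor. -/
theorem IsParent.unique (hR : R.Valid P) (hT : P.IsTown T) : ∀ m n n' : BagName V,
    R.IsParent P T m n → R.IsParent P T m n' → n = n' := by
  induction hT using hP.town_induction with
  | h T hT ih =>
    intro m n n' h h'
    have h0 : P.level T ≠ 0 := by
      cases h with
      | core h0 _ _ => exact h0
      | child hA _ => exact hP.level_ne_zero hA
      | join hA => exact hP.level_ne_zero hA
    rcases (h.isName hP hR).1.cases_of_level_ne_zero h0 with ⟨i, C, rfl, -⟩ | ⟨A, hA, hm⟩
    · obtain ⟨hi, y, hy, hC, rfl⟩ := h.of_core hP hR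
      obtain ⟨-, y', hy', hC', rfl⟩ := h'.of_core hP hR
      have hv := hR T hT h0
      have : y' ∈ R.cl T i y := by
        rw [← hC, hC']
        exact hv.mem_cl hi.le hy'
      rw [hv.cl_eq hi hy (hv.splitTree.refine_succ i hi y hy this)]
    · rcases h.of_child hP hR hA hm with h1 | ⟨rfl, rfl⟩ <;>
        rcases h'.of_child hP hR hA hm with h2 | ⟨h3, rfl⟩
      · exact ih A hA m n n' h1 h2
      · exact absurd (h3 ▸ h1) (not_isParent_rootName hP hR _)
      · exact absurd h2 (not_isParent_rootName hP hR _)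
      · rfl

omit [Finite V] hP in
/-- In `D_X` every bag is a descendant of the bags of the larger clusters. -/
theorem reflTransGen_core (h0 : P.level T ≠ 0) {i l : ℕ} (hil : i ≤ l) (hl : l ≤ R.top P T)
    {y : V} (hy : y ∈ R.Y P T) :
    Relation.ReflTransGen (R.IsParent P T) (T, i, R.cl T i y) (T, l, R.cl T l y) := by
  induction l, hil using Nat.le_induction with
  | base => rfl
  | succ l hil ih => exact (ih (by omega)).tail (.core h0 hl hy)

omit [Finite V] hP in
theorem IsCoreName.reflTransGen (hR : R.Valid P) (hT : P.IsTown T) {i : ℕ} {C : Set V}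
    (h : R.IsCoreName P T i C) :
    Relation.ReflTransGen (R.IsParent P T) (T, i, C) (R.rootName P T) := by
  obtain ⟨h0, hi, y, hy, rfl⟩ := h
  have := reflTransGen_core h0 hi le_rfl hy
  rw [(hR T hT h0).splitTree.highest y hy] at this
  simpa only [rootName, if_neg h0] using this

theorem IsName.reflTransGen (hR : R.Valid P) (hT : P.IsTown T) {n : BagName V}
    (hn : R.IsName P T n) : Relation.ReflTransGen (R.IsParent P T) n (R.rootName P T) := by
  induction hn with
  | single h => simp only [rootName, if_pos h]; rfl
  | core h => exact h.reflTransGen hR hT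
  | child hA _ ih =>
    refine (Relation.ReflTransGen.lift id (fun _ _ => IsParent.child hA) _ _ (ih hA.1)).trans
      (.head (.join hA) ?_)
    exact ((hR.validAt hP hA).isCoreName_conn hP hA).reflTransGen hR hT

/-! ### The contents of the bags -/

theorem InBag.isName_and_mem (hR : R.Valid P) (hT : P.IsTown T) {n : BagName V} {v : V}
    (h : R.InBag P T n v) : R.IsName P T n ∧ v ∈ T := by
  induction h with
  | single h0 hv => exact ⟨.single h0, hv⟩
  | @core T i C v h hv => exact ⟨.core h, (hR T hT h.1).X_subset hv.1⟩
  | child hA _ ih => exact ⟨.child hA (ih hA.1).1, hA.2.2.1.1 (ih hA.1).2⟩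
  | addConn hA hn hv => exact ⟨.child hA hn, (hR.validAt hP hA).X_subset hv.1⟩
  | addHubs hA hn hv => exact ⟨.child hA hn, hA.2.2.1.1 hv.2⟩
  | addHubsCore hA h _ _ hv => exact ⟨.core h, hA.2.2.1.1 hv.2⟩

theorem InBag.of_core (hR : R.Valid P) (h0 : P.level T ≠ 0) {i : ℕ} {C : Set V}
    {v : V} (h : R.InBag P T (T, i, C) v) : v ∈ R.coreBag P T i C ∨
      ∃ A, P.IsChild A T ∧ i ≤ R.connLevel P T A ∧ C ⊆ R.connCluster P T A ∧ v ∈ R.X P T ∩ A := by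
  generalize hn : (T, i, C) = n at h
  cases h with
  | single h => exact absurd h h0
  | core h hv =>
    simp only [Prod.mk.injEq, true_and] at hn
    obtain ⟨rfl, rfl⟩ := hn
    exact Or.inl hv
  | child hA h =>
    subst hn
    exact absurd rfl (not_isName_of_isChild hP hA (h.isName_and_mem hP hR hA.1).1)
  | addConn hA h _ => exact absurd (hn ▸ rfl) (not_isName_of_isChild hP hA h)
  | addHubs hA h _ => exact absurd (hn ▸ rfl) (not_isName_of_isChild hP hA h)
  | addHubsCore hA h hi hC hv =>
    simp only [Prod.mk.injEq, true_and] at hn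
    obtain ⟨rfl, rfl⟩ := hn
    exact Or.inr ⟨_, hA, hi, hC, hv⟩

theorem InBag.of_child (hR : R.Valid P) {A : Set V} (hA : P.IsChild A T) {n : BagName V}
    (hn : R.IsName P A n) {v : V} (h : R.InBag P T n v) :
    R.InBag P A n v ∨ v ∈ R.connBag P T A ∨ v ∈ R.X P T ∩ A := by
  cases h with
  | single h => exact absurd h (hP.level_ne_zero hA)
  | core h hv => exact absurd rfl (not_isName_of_isChild hP hA hn)
  | child hB h =>
    obtain rfl := child_eq_of_isName hP hA hB hn (h.isName_and_mem hP hR hB.1).1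
    exact Or.inl h
  | addConn hB h hv =>
    obtain rfl := child_eq_of_isName hP hA hB hn h
    exact Or.inr (Or.inl hv)
  | addHubs hB h hv =>
    obtain rfl := child_eq_of_isName hP hA hB hn h
    exact Or.inr (Or.inr hv)
  | addHubsCore hB h hi hC hv => exact absurd rfl (not_isName_of_isChild hP hA hn)

/-- The bags containing `v` form a subtree: one of them is the highest, and the parents of all
others contain `v` too. -/
theorem exists_highest_bag (hR : R.Valid P) (hT : P.IsTown T) : ∀ v ∈ T,
    ∃ t, R.InBag P T t v ∧ ∀ n, R.InBag P T n v → n ≠ t →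
      ∃ p, R.IsParent P T n p ∧ R.InBag P T p v := by
  induction hT using hP.town_induction with
  | h T hT ih =>
  intro v hv
  by_cases h0 : P.level T = 0
  · refine ⟨(T, 0, T), .single h0 hv, fun n hn hne => ?_⟩
    exact absurd ((hn.isName_and_mem hP hR hT).1.eq_of_level_eq_zero hP h0) hne
  obtain ⟨A, hA, hvA⟩ := hP.exists_child hT h0 hv
  have hval := hR T hT h0
  by_cases hvX : v ∈ R.X P T
  · -- the core bags with `v` are those of a path and those below the connecting bag of `A`
    set y := R.rep T v with hy_def
    have hy : y ∈ R.Y P T := ⟨v, hvX, rfl⟩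
    have hconn : R.connCluster P T A = R.cl T (R.connLevel P T A) y := by
      rw [hy_def, ← hval.rep_hub_eq hP hA ⟨hvX, hvA⟩]
      rfl
    have hAl : R.connLevel P T A ≤ R.top P T := ValidAt.connLevel_le A
    classical
    -- By the net hierarchy these levels form an initial segment, with maximum `m`.
    let I := (Finset.range (R.top P T + 1)).filter fun i => y ∈ R.net T i (R.cl T i y)
    have hI0 : 0 ∈ I := by simpa [I] using hval.mem_net_zero hy
    let m := I.max' ⟨0, hI0⟩
    have hmI : m ∈ I := I.max'_mem _
    have hm_top : m ≤ R.top P T := by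
      have := (Finset.mem_filter.1 hmI).1
      rw [Finset.mem_range] at this
      omega
    have hdown : ∀ i ≤ m, y ∈ R.net T i (R.cl T i y) := by
      intro i hi
      induction hi using Nat.decreasingInduction with
      | self => exact (Finset.mem_filter.1 hmI).2
      | of_succ i hi ih => exact hval.mem_net_of_mem_net_succ (by omega) hy ih
    -- characterization of the core bags that contain `v`
    have hchar : ∀ i C, R.IsCoreName P T i C → R.InBag P T (T, i, C) v →
        (i ≤ m ∧ C = R.cl T i y) ∨ (i ≤ R.connLevel P T A ∧ C ⊆ R.connCluster P T A) := by
      rintro i C ⟨-, hi, z, hz, rfl⟩ hin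
      rcases hin.of_core hP hR h0 with h | ⟨B, hB, h1, h2, h3⟩
      · have hmem : y ∈ R.net T i (R.cl T i z) := h.2
        have hcl : R.cl T i y = R.cl T i z := hval.cl_eq hi hz ((hval.isNet i hi z hz).1 hmem)
        refine Or.inl ⟨?_, hcl.symm⟩
        refine I.le_max' i (Finset.mem_filter.2 ⟨Finset.mem_range.2 (by omega), ?_⟩)
        rwa [hcl]
      · obtain rfl := hP.child_unique hA hB hvA h3.2
        exact Or.inr ⟨h1, h2⟩
    have hcore : ∀ i ≤ R.top P T, i ≤ m ∨ i ≤ R.connLevel P T A →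
        R.InBag P T (T, i, R.cl T i y) v := by
      intro i hi hor
      rcases hor with h | h
      · exact .core ⟨h0, hi, y, hy, rfl⟩ ⟨hvX, hdown i h⟩
      · refine .addHubsCore hA ⟨h0, hi, y, hy, rfl⟩ h ?_ ⟨hvX, hvA⟩
        rw [hconn]
        exact hval.cl_subset_cl h hAl hy
    -- The path ends at level `m` and the subtree at the level of the connecting bag, which lies on
    -- the same line of ancestors of `y`; the higher of the two is the topmost bag.
    set M := max m (R.connLevel P T A) with hM
    have hMtop : M ≤ R.top P T := max_le hm_top hAl
    refine ⟨(T, M, R.cl T M y), hcore M hMtop (le_max_iff.1 le_rfl), ?_⟩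
    intro n hn hne
    rcases (hn.isName_and_mem hP hR hT).1.cases_of_level_ne_zero h0 with
      ⟨i, C, rfl, hC⟩ | ⟨B, hB, hnB⟩
    · -- a path bag below the top bag
      have hpath : ∀ i < M, ∃ p, R.IsParent P T (T, i, R.cl T i y) p ∧ R.InBag P T p v := by
        intro i hi
        exact ⟨_, .core h0 (hi.trans_le hMtop) hy,
          hcore (i + 1) (by omega) (le_max_iff.1 hi)⟩
      rcases hchar i C hC hn with ⟨hi, rfl⟩ | ⟨hi, hsub⟩
      · rcases lt_or_eq_of_le (hi.trans (le_max_left m (R.connLevel P T A))) with h | h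
        · exact hpath i h
        · exact absurd (by rw [h]) hne
      -- Strictly below the connecting bag the parent still is in the subtree, possibly off the path
      -- of `y`; at its level the bag is on that path.
      · obtain ⟨-, hitop, z, hz, rfl⟩ := hC
        have hz' := (hval.cl_subset_connCluster_iff hA hi hz).1 hsub
        rcases hi.lt_or_eq with hlt | rfl
        · refine ⟨_, .core h0 (by omega) hz, .addHubsCore hA
            ⟨h0, by omega, z, hz, rfl⟩ hlt ?_ ⟨hvX, hvA⟩⟩
          exact (hval.cl_subset_connCluster_iff hA hlt hz).2 hz'
        · rw [hz', hconn] at hne ⊢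
          rcases lt_or_eq_of_le (le_max_right m (R.connLevel P T A)) with h | h
          · exact hpath _ h
          · exact absurd (by rw [hM, ← h]) hne
    · -- a bag of the decomposition of a child town `B`
      -- Only the root of `D_B` has its parent outside, namely the connecting bag.
      have hroot : n = R.rootName P B ∨ ∃ p, R.IsParent P B n p ∧ R.IsName P B p := by
        rcases Relation.ReflTransGen.cases_head (hnB.reflTransGen hP hR hB.1) with h | ⟨p, hp, -⟩
        · exact Or.inl h
        · exact Or.inr ⟨p, hp, (hp.isName hP hR).2⟩
      by_cases hBA : B = A
      · subst hBA
        rcases hroot with rfl | ⟨p, hp, hpB⟩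
        · refine ⟨_, .join hB, ?_⟩
          rw [hconn]
          exact hcore _ hAl (Or.inr le_rfl)
        · exact ⟨p, .child hB hp, .addHubs hB hpB ⟨hvX, hvA⟩⟩
      · have hvB : v ∉ B := fun h => hBA (hP.child_unique hB hA h hvA)
        have hvc : v ∈ R.connBag P T B := by
          rcases hn.of_child hP hR hB hnB with h | h | h
          · exact absurd (h.isName_and_mem hP hR hB.1).2 hvB
          · exact h
          · exact absurd h.2 hvB
        rcases hroot with rfl | ⟨p, hp, hpB⟩
        · exact ⟨_, .join hB, .core (hval.isCoreName_conn hP hB) hvc⟩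
        · exact ⟨p, .child hB hp, .addConn hB hpB hvc⟩
  · -- `v` is contained in bags of `D_A` only
    obtain ⟨t, ht, htop⟩ := ih A hA v hvA
    have hin : ∀ n, R.InBag P T n v → R.InBag P A n v := by
      intro n hn
      rcases (hn.isName_and_mem hP hR hT).1.cases_of_level_ne_zero h0 with
        ⟨i, C, rfl, hC⟩ | ⟨B, hB, hnB⟩
      · rcases hn.of_core hP hR h0 with h | ⟨B, -, -, -, h⟩
        · exact absurd h.1 hvX
        · exact absurd h.1 hvX
      · rcases hn.of_child hP hR hB hnB with h | h | h
        · exact hP.child_unique hB hA (h.isName_and_mem hP hR hB.1).2 hvA ▸ h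
        · exact absurd h.1 hvX
        · exact absurd h.1 hvX
    refine ⟨t, .child hA ht, fun n hn hne => ?_⟩
    obtain ⟨p, hp, hpv⟩ := htop n (hin n hn) hne
    exact ⟨p, .child hA hp, .child hA hpv⟩

theorem exists_inBag (hR : R.Valid P) (hT : P.IsTown T) {v : V} (hv : v ∈ T) :
    ∃ n, R.InBag P T n v :=
  (exists_highest_bag hP hR hT v hv).imp fun _ h => h.1

theorem exists_bag_of_isEdge (hR : R.Valid P) {u v : V}
    (h : R.IsEdge P T u v) : ∃ n, R.InBag P T n u ∧ R.InBag P T n v := by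
  induction h with
  | core h hu hv => exact ⟨_, .core h hu, .core h hv⟩
  | child hA _ ih =>
    obtain ⟨n, hu, hv⟩ := ih
    exact ⟨n, .child hA hu, .child hA hv⟩
  | join hA hu hv =>
    obtain ⟨n, hn⟩ := exists_inBag hP hR hA.1 hu
    exact ⟨n, .child hA hn, .addConn hA (hn.isName_and_mem hP hR hA.1).1 hv⟩

/-- Finiteness is needed for counting edges in `isTree_fromRel` and for indexing the bags by `Fin n`
in `treewidth_le`. -/
theorem finite_names (hT : P.IsTown T) : {n | R.IsName P T n}.Finite := by
  induction hT using hP.town_induction with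
  | h T hT ih =>
    have hsub : {n | R.IsName P T n} ⊆ {(T, 0, T)} ∪
        (fun p : ℕ × Set V => (T, p.1, p.2)) '' (Set.Iic (R.top P T) ×ˢ Set.univ) ∪
          ⋃ A ∈ {A | P.IsChild A T}, {n | R.IsName P A n} := by
      intro n hn
      cases hn with
      | single h => exact Or.inl (Or.inl rfl)
      | core h => exact Or.inl (Or.inr ⟨(_, _), ⟨h.2.1, trivial⟩, rfl⟩)
      | child hA h => exact Or.inr (Set.mem_biUnion hA h)
    refine Set.Finite.subset (((Set.finite_singleton _).union
      (((Set.finite_Iic _).prod Set.finite_univ).image _)).union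
        ((Set.toFinite _).biUnion fun A hA => ih A hA)) hsub

/-- `D_T` is a tree decomposition of `H_T`. -/
theorem isTreeDecomposition (hR : R.Valid P) (hT : P.IsTown T) :
    IsTreeDecomposition T (R.embedding P T).graph (R.decompTree P T) (R.decompBag P T) := by
  have : Finite {n : BagName V // R.IsName P T n} := finite_names hP hT
  let root : {n : BagName V // R.IsName P T n} := ⟨_, isName_rootName hP hR hT⟩
  have huniq : ∀ m n n' : {n : BagName V // R.IsName P T n}, R.IsParent P T m.1 n.1 →
      R.IsParent P T m.1 n'.1 → n = n' := fun m n n' h h' =>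
    Subtype.ext (IsParent.unique hP hR hT _ _ _ h h')
  have hroot : ∀ n : {n : BagName V // R.IsName P T n}, ¬ R.IsParent P T root.1 n.1 :=
    fun n => not_isParent_rootName hP hR n.1
  have hreach : ∀ m : {n : BagName V // R.IsName P T n},
      Relation.ReflTransGen (fun m n => R.IsParent P T m.1 n.1) m root := by
    rintro ⟨m, hm⟩
    have key : ∀ m, Relation.ReflTransGen (R.IsParent P T) m (R.rootName P T) →
        ∀ hm : R.IsName P T m, Relation.ReflTransGen
          (fun m n : {n : BagName V // R.IsName P T n} => R.IsParent P T m.1 n.1) ⟨m, hm⟩ root := by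
      intro m h
      induction h using Relation.ReflTransGen.head_induction_on with
      | refl => exact fun _ => .refl
      | head hab _ ih => exact fun hm => .head hab (ih (hab.isName hP hR).2)
    exact key m (hm.reflTransGen hP hR hT) hm
  refine ⟨isTree_fromRel huniq hroot hreach, ?_, fun u v huv => ?_, fun v hv => ?_⟩
  · ext v
    simp only [Set.mem_iUnion, decompBag, Set.mem_ofPred_eq]
    constructor
    · rintro ⟨n, hn⟩
      exact (hn.isName_and_mem hP hR hT).2
    · intro hv
      obtain ⟨n, hn⟩ := exists_inBag hP hR hT hv
      exact ⟨⟨n, (hn.isName_and_mem hP hR hT).1⟩, hn⟩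
  · have h := (SimpleGraph.fromRel_adj _ _ _).1 huv
    have key : ∀ a b, R.IsEdge P T a b → ∃ n, a ∈ R.decompBag P T n ∧ b ∈ R.decompBag P T n := by
      intro a b hab
      obtain ⟨n, ha, hb⟩ := exists_bag_of_isEdge hP hR hab
      exact ⟨⟨n, (ha.isName_and_mem hP hR hT).1⟩, ha, hb⟩
    rcases h.2 with h | h
    · exact key u v h
    · exact (key v u h).imp fun _ h => h.symm
  · obtain ⟨t, ht, htop⟩ := exists_highest_bag hP hR hT v hv
    refine connected_induce_fromRel huniq hroot hreach
      (t := ⟨t, (ht.isName_and_mem hP hR hT).1⟩) ht fun n hn hne => ?_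
    obtain ⟨p, hp, hpv⟩ := htop n.1 hn fun h => hne (Subtype.ext h)
    exact ⟨⟨p, (hp.isName hP hR).2⟩, hpv, hp⟩

end Choices

/-- The width of a finite tree decomposition bounds the treewidth. -/
theorem treewidth_le {V ι : Type*} [Finite ι] {S : Set V} {H : SimpleGraph V}
    {D : SimpleGraph ι} {bag : ι → Set V} (h : IsTreeDecomposition S H D bag) {w : ℕ}
    (hw : ∀ n, (bag n).ncard - 1 ≤ w) : treewidth S H ≤ w := by
  obtain ⟨n, ⟨e⟩⟩ := Finite.exists_equiv_fin ι
  let f : D ≃g D.map e.toEmbedding := SimpleGraph.Iso.map e D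
  refine Nat.sInf_le ⟨n, D.map e.toEmbedding, fun i => bag (e.symm i),
    ⟨f.isTree_iff.1 h.isTree, ?_, ?_, ?_⟩, fun i => hw _⟩
  · rw [← h.union_eq]
    exact e.symm.surjective.iUnion_comp bag
  · intro u v huv
    obtain ⟨i, hu, hv⟩ := h.edge u v huv
    exact ⟨e i, by simpa using hu, by simpa using hv⟩
  · intro v hv
    have hc := h.connected v hv
    let g : D.induce {n | v ∈ bag n} ≃g
        (D.map e.toEmbedding).induce {i | v ∈ bag (e.symm i)} :=
      { toEquiv := e.subtypeEquiv (by intro a; simp)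
        map_rel_iff' := by
          intro a b
          exact f.map_adj_iff }
    exact g.connected_iff.1 hc

/-! ### The construction can be carried out -/

namespace WGraph

variable {V : Type*} {G : WGraph V}

/-- A maximal separated subset is a net: a vertex far from all of it could be added. -/
theorem exists_isNet [Finite V] (hpos : ∀ e ∈ G.graph.edgeSet, 0 < G.len e) {δ : ℝ} (hδ : 0 ≤ δ)
    (S : Set V) : ∃ N, G.IsNet δ N S := by
  obtain ⟨N, -, hN⟩ := (Set.toFinite {N : Set V | N ⊆ S ∧
    ∀ u ∈ N, ∀ v ∈ N, u ≠ v → δ < G.dist u v}).exists_le_maximal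
      (show (∅ : Set V) ∈ _ from ⟨Set.empty_subset _, by simp⟩)
  refine ⟨N, hN.prop.1, fun u hu => ?_, hN.prop.2⟩
  by_contra hno
  push Not at hno
  have huN : u ∈ N := by
    refine hN.le_of_ge (y := insert u N) ⟨Set.insert_subset hu hN.prop.1, ?_⟩
      (Set.subset_insert _ _) (Set.mem_insert _ _)
    rintro a (rfl | ha) b (rfl | hb) hab
    · exact absurd rfl hab
    · exact hno b hb
    · rw [G.dist_comm]
      exact hno a ha
    · exact hN.prop.2 a ha b hb hab
  exact absurd (hno u huN) (not_lt.2 (by rwa [dist_self hpos]))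

end WGraph

noncomputable section

namespace Setup

variable {V : Type*} (P : Setup V)

/-- `h` is moved to a hub of a lower level if there is one close by. -/
def greedyShift (T : Set V) (i : ℕ) (h : V) : V :=
  open Classical in
  -- The inequality is bound as a witness so that the recursion on the level is seen to terminate.
  if hex : ∃ h', (∃ l, ∃ _ : l < i, 1 ≤ l ∧ h' ∈ (fun x => greedyShift T l x) ''
      (P.core T l ∩ P.spc l)) ∧ P.G.dist h h' ≤ P.ε * P.r i then hex.choose else h
termination_by i

/-- Every child town is represented by one of its approximate core hubs in `X`. -/
def childRep [Nonempty V] (T X : Set V) (x : V) : V :=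
  Classical.epsilon fun y => y ∈ X ∧ ∃ A, P.IsChild A T ∧ x ∈ A ∧ y ∈ A

/-- The approximate core hubs for greedy shifts. -/
def greedyX (T : Set V) : Set V :=
  {x | ∃ i, 1 ≤ i ∧ i < P.level T ∧ x ∈ P.greedyShift T i '' (P.core T i ∩ P.spc i)}

/-- Choices with greedy shifts and one representative for every child town. -/
def shiftChoices [Nonempty V] : Choices V where
  shift := P.greedyShift
  rep T := P.childRep T (P.greedyX T)
  -- Dummy values: `X`, `Y` and `top` depend only on `shift` and `rep`, so they are available for
  -- defining the remaining choices.
  cl _ _ _ := ∅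
  net _ _ _ := ∅
  hub _ _ := Classical.arbitrary V

/-- Choices whose split trees split all clusters at the highest level. -/
def greedyChoices [Nonempty V] : Choices V where
  shift := P.shiftChoices.shift
  rep := P.shiftChoices.rep
  cl T i y := open Classical in if i < P.shiftChoices.top P T then {y} else P.shiftChoices.Y P T
  net T i C := open Classical in
    if i < P.shiftChoices.top P T then C else
      Classical.epsilon fun N => P.G.IsNet (P.β * 2 ^ i) N C
  hub T A := Classical.epsilon fun x => x ∈ P.shiftChoices.X P T ∧
    ∀ x' ∈ P.shiftChoices.X P T, P.G.setDist A {x} ≤ P.G.setDist A {x'}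

variable {P}

theorem greedyShift_lower {T : Set V} {i : ℕ} {h : V}
    (hex : ∃ l, 1 ≤ l ∧ l < i ∧ ∃ h' ∈ P.greedyShift T l '' (P.core T l ∩ P.spc l),
      P.G.dist h h' ≤ P.ε * P.r i) :
    (∃ l, 1 ≤ l ∧ l < i ∧ P.greedyShift T i h ∈ P.greedyShift T l '' (P.core T l ∩ P.spc l)) ∧
      P.G.dist h (P.greedyShift T i h) ≤ P.ε * P.r i := by
  obtain ⟨l, hl1, hli, h', hh', hd⟩ := hex
  have hex' : ∃ h', (∃ l, ∃ _ : l < i, 1 ≤ l ∧ h' ∈ (fun x => P.greedyShift T l x) ''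
      (P.core T l ∩ P.spc l)) ∧ P.G.dist h h' ≤ P.ε * P.r i := ⟨h', ⟨l, hli, hl1, hh'⟩, hd⟩
  have he : P.greedyShift T i h = hex'.choose := by rw [greedyShift, dif_pos hex']
  rw [he]
  obtain ⟨⟨l, hl, h1, hm⟩, hd⟩ := hex'.choose_spec
  exact ⟨⟨l, h1, hl, hm⟩, hd⟩

theorem greedyShift_self {T : Set V} {i : ℕ} {h : V}
    (hno : ¬ ∃ l, 1 ≤ l ∧ l < i ∧ ∃ h' ∈ P.greedyShift T l '' (P.core T l ∩ P.spc l),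
      P.G.dist h h' ≤ P.ε * P.r i) : P.greedyShift T i h = h := by
  rw [greedyShift, dif_neg]
  rintro ⟨h', ⟨l, hli, h1, hh'⟩, hd⟩
  exact hno ⟨l, h1, hli, h', hh', hd⟩

theorem childRep_spec [Nonempty V] {T X A : Set V} (hA : P.IsChild A T) {x : V} (hx : x ∈ X)
    (hxA : x ∈ A) :
    P.childRep T X x ∈ X ∧ ∃ A, P.IsChild A T ∧ x ∈ A ∧ P.childRep T X x ∈ A :=
  Classical.epsilon_spec (p := fun y => y ∈ X ∧ ∃ A, P.IsChild A T ∧ x ∈ A ∧ y ∈ A)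
    ⟨x, hx, A, hA, hxA, hxA⟩

namespace Admissible

variable {lam : ℝ} [Finite V] (hP : P.Admissible lam)

include hP

/-- Two vertices of one child town define the same predicate, and `epsilon` depends on nothing else.
-/
theorem childRep_eq [Nonempty V] {T X A : Set V} (hA : P.IsChild A T) {x y : V}
    (hxA : x ∈ A) (hyA : y ∈ A) : P.childRep T X x = P.childRep T X y := by
  have key : ∀ a b z, a ∈ A → b ∈ A → (∃ B, P.IsChild B T ∧ a ∈ B ∧ z ∈ B) →
      ∃ B, P.IsChild B T ∧ b ∈ B ∧ z ∈ B := by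
    rintro a b z ha hb ⟨B, hB, haB, hz⟩
    obtain rfl := hP.child_unique hA hB ha haB
    exact ⟨A, hA, hb, hz⟩
  unfold childRep
  congr 1
  funext z
  rw [eq_iff_iff]
  exact and_congr_right fun _ => ⟨key x y z hxA hyA, key y x z hyA hxA⟩

/-- A set of diameter zero has level `0` only in its split tree. -/
theorem top_eq_zero {Y : Set V} (h : ⌈Real.logb 2 (P.G.diam Y)⌉₊ = 0) {y z : V} (hy : y ∈ Y)
    (hz : z ∈ Y) : z = y := by
  by_contra hne
  have h1 := hP.two_lt_dist hne
  have h2 : P.G.dist z y ≤ P.G.diam Y := WGraph.dist_le_diam hz hy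
  rw [Nat.ceil_eq_zero] at h
  have h3 : 0 < Real.logb 2 (P.G.diam Y) := Real.logb_pos (by norm_num) (by linarith)
  linarith

theorem diam_le_pow {Y : Set V} {y z : V} (hy : y ∈ Y) (hz : z ∈ Y) :
    P.G.dist y z ≤ 2 ^ ⌈Real.logb 2 (P.G.diam Y)⌉₊ := by
  rcases (hP.dist_nonneg y z).eq_or_lt with h | h
  · rw [← h]
    positivity
  have h1 : P.G.dist y z ≤ P.G.diam Y := WGraph.dist_le_diam hy hz
  refine h1.trans ?_
  rw [← Real.rpow_natCast, ← Real.logb_le_iff_le_rpow (by norm_num) (by linarith)]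
  exact Nat.le_ceil _

/-- Clusters need not shrink gradually: singletons below the top level and all of `Y_T` at the top
form a split tree, and only the top cluster needs a genuine net. If the top level is `0`, both
descriptions agree, since `Y_T` is then a single vertex. -/
theorem valid_greedyChoices [Nonempty V] (hβ : 0 ≤ P.β) : P.greedyChoices.Valid P := by
  classical
  intro T hT h0
  set R := P.greedyChoices with hR
  have hXT : R.X P T ⊆ T := by
    rintro x ⟨i, h1, hi, hx⟩
    induction i using Nat.strong_induction_on generalizing x with
    | _ i ih =>
      obtain ⟨h, hh, rfl⟩ := hx
      by_cases hex : ∃ l, 1 ≤ l ∧ l < i ∧ ∃ h' ∈ P.greedyShift T l '' (P.core T l ∩ P.spc l),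
        P.G.dist h h' ≤ P.ε * P.r i
      · obtain ⟨⟨l, hl, hli, hmem⟩, -⟩ := greedyShift_lower hex
        exact ih l hli hl (hli.trans hi) hmem
      · have : P.greedyShift T i h = h := greedyShift_self hex
        change P.greedyShift T i h ∈ T
        rw [this]
        exact hh.1.1
  have hXA : ∀ x ∈ R.X P T, ∃ A, P.IsChild A T ∧ x ∈ A := fun x hx =>
    hP.exists_child hT h0 (hXT hx)
  have hrep : ∀ x ∈ R.X P T, R.rep T x ∈ R.X P T ∧ ∃ A, P.IsChild A T ∧ x ∈ A ∧
      R.rep T x ∈ A := by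
    intro x hx
    obtain ⟨A, hA, hxA⟩ := hXA x hx
    exact childRep_spec hA hx hxA
  have hcl : ∀ i y, R.cl T i y = if i < R.top P T then {y} else R.Y P T := fun _ _ => rfl
  have hnet : ∀ i C, R.net T i C = if i < R.top P T then C else
      Classical.epsilon fun N => P.G.IsNet (P.β * 2 ^ i) N C := fun _ _ => rfl
  have htop : ∀ y ∈ R.Y P T, R.cl T (R.top P T) y = R.Y P T := fun y _ => by
    rw [hcl, if_neg (lt_irrefl _)]
  have hlow : ∀ i < R.top P T, ∀ y, R.cl T i y = {y} := fun i hi y => by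
    rw [hcl, if_pos hi]
  have hN : ∀ C, P.G.IsNet (P.β * 2 ^ R.top P T) (R.net T (R.top P T) C) C := fun C => by
    rw [hnet, if_neg (lt_irrefl _)]
    exact Classical.epsilon_spec (WGraph.exists_isNet hP.pos (by positivity) C)
  have hcases : ∀ i ≤ R.top P T, i = R.top P T ∨ i < R.top P T := fun i hi => hi.eq_or_lt
  have hhub : ∀ A, R.hub T A ∈ R.X P T ∧
      ∀ x' ∈ R.X P T, P.G.setDist A {R.hub T A} ≤ P.G.setDist A {x'} := by
    intro A
    refine Classical.epsilon_spec (p := fun x => x ∈ R.X P T ∧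
      ∀ x' ∈ R.X P T, P.G.setDist A {x} ≤ P.G.setDist A {x'}) ?_
    obtain ⟨x, hx, hmin⟩ := Set.exists_min_image (R.X P T) (fun x => P.G.setDist A {x})
      (Set.toFinite _) (Choices.X_nonempty hP hT h0)
    exact ⟨x, hx, hmin⟩
  refine
    { shift_lower := fun i _ _ h _ hex => greedyShift_lower hex
      shift_self := fun i _ _ h _ hno => greedyShift_self hno
      rep_mem := fun x hx => (hrep x hx).1
      rep_child := fun A hA x hx hxA => ?_
      rep_eq := fun A hA x _ y _ hxA hyA => hP.childRep_eq hA hxA hyA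
      splitTree := ⟨?_, ?_, ?_, ?_, htop, ?_, ?_⟩
      isNet := ?_
      hierarchy := ?_
      hub_mem := fun A _ => (hhub A).1
      hub_closest := fun A _ => (hhub A).2 }
  · obtain ⟨-, B, hB, hxB, h⟩ := hrep x hx
    rwa [hP.child_unique hA hB hxA hxB]
  · intro i hi y hy
    rcases hcases i hi with rfl | h
    · rwa [htop y hy]
    · rw [hlow i h]
      rfl
  · intro i hi y hy
    rcases hcases i hi with rfl | h
    · rw [htop y hy]
    · rw [hlow i h]
      exact Set.singleton_subset_iff.2 hy
  · intro i hi y hy z hz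
    rcases hcases i hi with rfl | h
    · rw [htop y hy] at hz ⊢
      exact htop z hz
    · rw [hlow i h] at hz ⊢
      rw [hz, hlow i h]
  · intro i hi y hy
    rw [hlow i hi]
    rcases hcases (i + 1) hi with h | h
    · rw [h, htop y hy]
      exact Set.singleton_subset_iff.2 hy
    · rw [hlow _ h]
  · intro y hy
    rcases hcases 0 (Nat.zero_le _) with h | h
    · rw [h, htop y hy]
      exact Set.eq_singleton_iff_unique_mem.2 ⟨hy, fun z hz => hP.top_eq_zero h.symm hy hz⟩
    · exact hlow 0 h y
  · intro i hi y hy z hz z' hz'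
    rcases hcases i hi with rfl | h
    · rw [htop y hy] at hz hz'
      refine (hP.diam_le_pow hz hz').trans ?_
      exact pow_le_pow_right₀ (by norm_num) (Nat.le_succ _)
    · rw [hlow i h] at hz hz'
      rw [hz, hz', hP.dist_self]
      positivity
  · intro i hi y hy
    rcases hcases i hi with rfl | h
    · exact hN _
    · rw [hnet, if_pos h, hlow i h]
      refine ⟨subset_rfl, fun u hu => ⟨u, hu, ?_⟩, fun u hu v hv hne => ?_⟩
      · rw [hP.dist_self]
        positivity
      · exact absurd ((hu : u = y).trans (hv : v = y).symm) hne
  · intro i hi y hy v hv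
    have hv' : v ∈ R.cl T (i + 1) y := by
      rcases hcases (i + 1) hi with h | h
      · rw [h] at hv ⊢
        exact (hN _).1 hv
      · rwa [hnet, if_pos h] at hv
    refine ⟨v, hv', ?_⟩
    rw [hnet, if_pos hi, hlow i hi]
    rfl

end Admissible

end Setup

end

/-! ### Packings of approximate core hubs -/

theorem Set.ncard_biUnion_finset_le_mul {ι V : Type*} [Finite V] (S : Finset ι) (f : ι → Set V)
    {n : ℕ} (h : ∀ i ∈ S, (f i).ncard ≤ n) : (⋃ i ∈ S, f i).ncard ≤ S.card * n := by
  classical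
  have := Fintype.ofFinite V
  have h1 := Finset.card_biUnion_le_card_mul S (fun i => (f i).toFinset) n fun i hi => by
    rw [← Set.ncard_eq_toFinset_card']
    exact h i hi
  rw [Set.ncard_eq_toFinset_card']
  refine le_trans (Finset.card_le_card ?_) h1
  intro x hx
  simpa using hx

theorem Set.ncard_biUnion_le_mul {ι V : Type*} [Finite ι] [Finite V] (S : Set ι) (f : ι → Set V)
    {n : ℕ} (h : ∀ i ∈ S, (f i).ncard ≤ n) : (⋃ i ∈ S, f i).ncard ≤ S.ncard * n := by
  classical
  have := Fintype.ofFinite ι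
  have h1 := Set.ncard_biUnion_finset_le_mul S.toFinset f fun i hi => h i (Set.mem_toFinset.1 hi)
  rw [Set.ncard_eq_toFinset_card' S]
  simpa only [Set.mem_toFinset] using h1

namespace Setup

/-- The number of balls of radius `2 * r l` that cover the sprawl of level `l` in a ball of radius
`2 * r (l + 1)`. -/
noncomputable def coverNumber (lam : ℝ) (k s : ℕ) : ℕ := (⌈2 / lam⌉₊ + 1) * k * (1 + s)

variable {V : Type*} {P : Setup V}

theorem core_mono {T : Set V} {i l : ℕ} (h : i ≤ l) : P.core T i ⊆ P.core T l :=
  fun _ hv => ⟨hv.1, fun l' hl' => hv.2 l' (h.trans hl')⟩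

namespace Admissible

variable {lam : ℝ} [Finite V] (hP : P.Admissible lam)

include hP

/-- A vertex `u` of the sprawl has a hub `h` within `2 * ρ`. If `h` is farther than `ρ`, the path
from `u` to `h` is long enough to be hit by a highway hitting set. Otherwise `h` lies on a path of
length in `(ρ, c * ρ / 2]`, which is hit at some `z`, and `h` is one of at most `s` hubs near `z`.
The second case needs hitting sets for `M` different scales. -/
theorem exists_cover {s : ℕ} {l : ℕ} (hs : P.G.LocallySparse P.c (P.r l) s (P.spc l)) (v : V) :
    ∃ F : Set V, F.ncard ≤ coverNumber lam (P.G.highwayDimension P.c) s ∧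
      ∀ u ∈ P.sprawl l, u ∈ P.G.ball v (2 * P.r (l + 1)) → ∃ f ∈ F, u ∈ P.G.ball f (2 * P.r l) := by
  set ρ := P.r l with hρ
  have hρ0 : 0 < ρ := hP.r_pos l
  have hl0 := hP.lam_pos
  have hc := hP.c_eq
  set M := ⌈2 / lam⌉₊ + 1 with hM
  -- `M` windows of width `lam / 2` starting at `1` reach beyond `c / 2 = 2 + lam / 2`.
  have hMl : 1 + lam / 2 ≤ M * (lam / 2) := by
    have h1 : 2 / lam ≤ (⌈2 / lam⌉₊ : ℝ) := Nat.le_ceil _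
    rw [div_le_iff₀ hl0] at h1
    push_cast [hM]
    linarith
  have hrq : ∀ q : ℕ, 0 < (1 + q * (lam / 2)) * ρ := fun q => by positivity
  choose K hKcard hK using fun q : ℕ => WGraph.exists_hittingSet (G := P.G) P.c (hrq q) v
  set Z : Set V := ⋃ q ∈ Finset.range M, K q with hZ
  have hZcard : Z.ncard ≤ M * P.G.highwayDimension P.c := by
    have := Set.ncard_biUnion_finset_le_mul (Finset.range M) K fun q _ => hKcard q
    rwa [Finset.card_range] at this
  refine ⟨Z ∪ ⋃ z ∈ Z, P.spc l ∩ P.G.ball z (P.c * ρ / 2), ?_, ?_⟩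
  · refine (Set.ncard_union_le _ _).trans ?_
    refine (Nat.add_le_add hZcard ((Set.ncard_biUnion_le_mul Z _ fun z _ => hs z).trans
      (Nat.mul_le_mul_right s hZcard))).trans (le_of_eq ?_)
    rw [coverNumber]
    ring
  · intro u hu huv
    simp only [WGraph.ball, Set.mem_ofPred_eq, r_succ, ← hρ] at huv
    obtain ⟨h, hh, huh⟩ := hP.exists_hub_of_mem_sprawl hu
    rw [← hρ] at huh
    by_cases hfar : ρ < P.G.dist u h
    · -- the shortest path from `u` to its hub is hit
      obtain ⟨p, hp⟩ := WGraph.exists_isShortestPath hP.conn hP.pos u h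
      have h0 := hK 0 u h p hp (fun z hz => ?_) (by rw [hp.2]; simpa using hfar)
      · obtain ⟨z, hz, hzp⟩ := h0
        refine ⟨z, Or.inl (Set.mem_biUnion (Finset.mem_range.2 (Nat.succ_pos _)) hz), ?_⟩
        have := hp.dist_add_dist hP.conn hP.pos hzp
        have := hP.dist_nonneg z h
        simp only [WGraph.ball, Set.mem_ofPred_eq]
        linarith
      · have h1 := hp.dist_add_dist hP.conn hP.pos hz
        have h2 := hP.dist_nonneg z h
        have h3 := hP.dist_triangle z u v
        rw [P.G.dist_comm z u] at h3
        simp only [WGraph.ball, Set.mem_ofPred_eq, Nat.cast_zero, zero_mul, add_zero, one_mul]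
        nlinarith
    · -- the hub lies on a path that is hit
      rw [not_lt] at hfar
      obtain ⟨x, y, p, hp, hhp, hL1, hL2⟩ := hP.exists_path_of_mem_spc hh
      rw [← hρ] at hL1 hL2
      have hwin : ∃ q < M, (1 + q * (lam / 2)) * ρ < P.G.walkLen p ∧
          P.G.walkLen p ≤ (1 + (q + 1 : ℕ) * (lam / 2)) * ρ := by
        classical
        have hex : ∃ q : ℕ, P.G.walkLen p ≤ (1 + (q + 1 : ℕ) * (lam / 2)) * ρ := by
          refine ⟨M, hL2.trans ?_⟩
          push_cast
          nlinarith [mul_le_mul_of_nonneg_right hMl hρ0.le, mul_pos hl0 hρ0]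
        have hlast : P.G.walkLen p ≤ (1 + ((M - 1 + 1 : ℕ) : ℝ) * (lam / 2)) * ρ := by
          refine hL2.trans ?_
          rw [show M - 1 + 1 = M from rfl]
          nlinarith [mul_le_mul_of_nonneg_right hMl hρ0.le]
        refine ⟨Nat.find hex, ?_, ?_, Nat.find_spec hex⟩
        · have := Nat.find_min' hex hlast
          omega
        · rcases hn : Nat.find hex with _ | n
          · simpa using hL1
          · exact not_le.1 (Nat.find_min hex (m := n) (by omega))
      obtain ⟨q, hqM, hq1, hq2⟩ := hwin
      have hdist : ∀ a ∈ p.support, ∀ b ∈ p.support, P.G.dist a b ≤ P.G.walkLen p := by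
        intro a ha b hb
        have h1 := hp.dist_add_dist hP.conn hP.pos ha
        have h2 := hp.dist_add_dist hP.conn hP.pos hb
        have h3 := hP.dist_triangle a x b
        have h4 := hP.dist_triangle a y b
        rw [P.G.dist_comm a x] at h3
        rw [P.G.dist_comm y b] at h4
        rw [hp.2]
        linarith
      obtain ⟨z, hz, hzp⟩ := hK q x y p hp (fun z hz => by
        have h1 := hdist z hz h hhp
        have h2 := hP.dist_triangle z h v
        have h3 := hP.dist_triangle h u v
        rw [P.G.dist_comm h u] at h3
        simp only [WGraph.ball, Set.mem_ofPred_eq]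
        push_cast at hq2
        have hq0 : (0 : ℝ) ≤ q := q.cast_nonneg
        -- The summands are the path length `1 + (q + 1) * (lam / 2)`, then `1` from `h` to `u`, and
        -- `c / 2` from `u` to `v`, in units of `ρ`. The total is at most `c * (1 + q * (lam / 2))`;
        -- the violation pays for the width of the window.
        have h4 : P.G.dist z v ≤ (4 + lam + q * (lam / 2)) * ρ := by
          rw [hc] at huv
          nlinarith
        refine h4.trans ?_
        rw [hc, ← mul_assoc]
        refine mul_le_mul_of_nonneg_right ?_ hρ0.le
        nlinarith [mul_nonneg hq0 hl0.le, mul_nonneg (mul_nonneg hq0 hl0.le) hl0.le]) hq1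
      refine ⟨h, Or.inr (Set.mem_biUnion (Set.mem_biUnion (Finset.mem_range.2 hqM) hz) ⟨hh, ?_⟩),
        ?_⟩
      · exact (hdist h hhp z hzp).trans hL2
      · exact hfar.trans (by linarith)

/-- The core in a ball is covered by few smaller balls. -/
theorem exists_cover_core {s : ℕ} (hs : ∀ i, P.G.LocallySparse P.c (P.r i) s (P.spc i))
    {T : Set V} {m L : ℕ} (hmL : m ≤ L) (hL : L ≤ P.level T) (v : V) :
    ∃ F : Set V, F.ncard ≤ coverNumber lam (P.G.highwayDimension P.c) s ^ (L - m) ∧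
      ∀ u ∈ P.core T m, u ∈ P.G.ball v (2 * P.r L) → ∃ f ∈ F, u ∈ P.G.ball f (2 * P.r m) := by
  induction L, hmL using Nat.le_induction generalizing v with
  | base => exact ⟨{v}, by simp, fun u _ hu => ⟨v, rfl, hu⟩⟩
  | succ L hmL ih =>
    obtain ⟨F, hF, hcov⟩ := hP.exists_cover (hs L) v
    choose F' hF' hcov' using ih (by omega)
    refine ⟨⋃ f ∈ F, F' f, ?_, fun u hu huv => ?_⟩
    · refine (Set.ncard_biUnion_le_mul F F' fun f _ => hF' f).trans ?_
      rw [show L + 1 - m = (L - m) + 1 by omega, pow_succ']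
      exact Nat.mul_le_mul_right _ hF
    · obtain ⟨f, hf, huf⟩ := hcov u (hu.2 L hmL hL) huv
      obtain ⟨f', hf', huf'⟩ := hcov' f u hu huf
      exact ⟨f', Set.mem_biUnion hf hf', huf'⟩

end Admissible

end Setup

namespace Choices

variable {V : Type*} (R : Choices V) (P : Setup V)

/-- The lowest level on which `x` is an approximate core hub of `T`. -/
noncomputable def hubLevel (T : Set V) (x : V) : ℕ :=
  sInf {i | 1 ≤ i ∧ i < P.level T ∧ x ∈ R.XLevel P T i}

variable {R P} {T : Set V}

theorem hubLevel_spec {x : V} (hx : x ∈ R.X P T) :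
    1 ≤ R.hubLevel P T x ∧ R.hubLevel P T x < P.level T ∧
      x ∈ R.XLevel P T (R.hubLevel P T x) :=
  Nat.sInf_mem (s := {i | 1 ≤ i ∧ i < P.level T ∧ x ∈ R.XLevel P T i}) hx

/-- On the lowest level where `x` occurs it cannot have been moved there, since moved hubs already
occur on a lower level. So `x` is a genuine core hub and far from all lower approximate core hubs.
-/
theorem ValidAt.exists_eq_of_mem_X (hR : R.ValidAt P T) {x : V} (hx : x ∈ R.X P T) :
    x ∈ P.core T (R.hubLevel P T x) ∩ P.spc (R.hubLevel P T x) ∧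
      ∀ l, 1 ≤ l → l < R.hubLevel P T x → ∀ y ∈ R.XLevel P T l,
        P.ε * P.r (R.hubLevel P T x) < P.G.dist x y := by
  obtain ⟨h1, h2, h, hh, hx'⟩ := hubLevel_spec hx
  have hno : ¬ ∃ l, 1 ≤ l ∧ l < R.hubLevel P T x ∧ ∃ h' ∈ R.XLevel P T l,
      P.G.dist h h' ≤ P.ε * P.r (R.hubLevel P T x) := by
    intro hex
    obtain ⟨⟨l, hl1, hl, hmem⟩, -⟩ := hR.shift_lower _ h1 h2 h hh hex
    rw [hx'] at hmem
    exact absurd (Nat.sInf_le (s := {i | 1 ≤ i ∧ i < P.level T ∧ x ∈ R.XLevel P T i})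
      ⟨hl1, hl.trans h2, hmem⟩) (not_le.2 hl)
  have hself := hR.shift_self _ h1 h2 h hh hno
  rw [hx'] at hself
  subst hself
  refine ⟨hh, fun l hl1 hl y hy => ?_⟩
  by_contra hle
  exact hno ⟨l, hl1, hl, y, hy, not_lt.1 hle⟩

/-- A set of approximate core hubs in a ball is small if its hubs of low levels are far apart. -/
theorem ValidAt.ncard_packing_le {lam : ℝ} [Finite V] (hP : P.Admissible lam)
    (hR : R.ValidAt P T) {s : ℕ} (hs : ∀ i, P.G.LocallySparse P.c (P.r i) s (P.spc i))
    (hs1 : 1 ≤ s) (hN : 1 ≤ Setup.coverNumber lam (P.G.highwayDimension P.c) s)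
    {w : ℕ} (hw : 4 ≤ P.ε * (P.c / 4) ^ w) {m L : ℕ} (hmL : m ≤ L) (hL : L ≤ P.level T) {v : V}
    {Z : Set V} (hZX : Z ⊆ R.X P T) (hZ : Z ⊆ P.G.ball v (2 * P.r L))
    (hlow : ∀ x ∈ Z, ∀ y ∈ Z, R.hubLevel P T x ≤ m → R.hubLevel P T y ≤ m → x ≠ y →
      4 * P.r m < P.G.dist x y) :
    Z.ncard ≤ Setup.coverNumber lam (P.G.highwayDimension P.c) s ^ (L - m) * s *
      (L - m + w + 2) := by
  classical
  set N := Setup.coverNumber lam (P.G.highwayDimension P.c) s with hNdef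
  set lev := R.hubLevel P T with hlev
  have hspec : ∀ x ∈ Z, x ∈ P.core T (lev x) ∩ P.spc (lev x) := fun x hx =>
    (hR.exists_eq_of_mem_X (hZX hx)).1
  -- Covering balls for level `i + 1` are exactly the balls in which the cover of level `i` is
  -- sparse.
  have hr : ∀ i, 2 * P.r (i + 1) = P.c * P.r i / 2 := fun i => by
    rw [Setup.Admissible.r_succ]
    ring
  -- hubs of low levels
  have h1 : {x ∈ Z | lev x ≤ m}.ncard ≤ N ^ (L - m) := by
    obtain ⟨F, hF, hcov⟩ := hP.exists_cover_core hs hmL hL v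
    have hex : ∀ x ∈ {x ∈ Z | lev x ≤ m}, ∃ f ∈ F, x ∈ P.G.ball f (2 * P.r m) := fun x hx =>
      hcov x (Setup.core_mono hx.2 (hspec x hx.1).1) (hZ hx.1)
    choose! f hf hball using hex
    -- Separation by more than `4 * r m` leaves at most one hub in each covering ball.
    refine (Set.ncard_le_ncard_of_injOn f hf ?_ (Set.toFinite _)).trans hF
    intro x hx y hy hxy
    by_contra hne
    have h1 := hlow x hx.1 y hy.1 hx.2 hy.2 hne
    have h2 : P.G.dist x (f x) ≤ _ := hball x hx
    have h3 : P.G.dist y (f y) ≤ _ := hball y hy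
    have h4 := hP.dist_triangle x (f x) y
    rw [P.G.dist_comm y, ← hxy] at h3
    linarith
  -- hubs of one level that is high enough
  have hone : ∀ i, L ≤ i → {x ∈ Z | lev x = i}.ncard ≤ s := by
    intro i hi
    refine le_trans (Set.ncard_le_ncard ?_ (Set.toFinite _)) (hs i v)
    rintro x ⟨hx, rfl⟩
    have h4 : P.G.dist x v ≤ _ := hZ hx
    refine ⟨(hspec x hx).2, ?_⟩
    simp only [WGraph.ball, Set.mem_ofPred_eq]
    rw [← hr]
    linarith [hP.r_mono (hi.trans (Nat.le_succ _))]
  have hpow : 1 ≤ N ^ (L - m) := Nat.one_le_pow _ _ hN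
  -- hubs of one medium level
  have h2 : ∀ i ∈ Finset.Ioo m (L + w), {x ∈ Z | lev x = i}.ncard ≤ N ^ (L - m) * s := by
    intro i hi
    rw [Finset.mem_Ioo] at hi
    rcases le_or_gt L i with h | h
    · exact (hone i h).trans (Nat.le_mul_of_pos_left _ hpow)
    · obtain ⟨F, hF, hcov⟩ := hP.exists_cover_core hs (m := i + 1) h hL v
      have hsub : {x ∈ Z | lev x = i} ⊆ ⋃ f ∈ F, P.spc i ∩ P.G.ball f (P.c * P.r i / 2) := by
        rintro x ⟨hx, rfl⟩
        obtain ⟨f, hf, hxf⟩ := hcov x (Setup.core_mono (Nat.le_succ _) (hspec x hx).1) (hZ hx)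
        rw [hr] at hxf
        exact Set.mem_biUnion hf ⟨(hspec x hx).2, hxf⟩
      refine (Set.ncard_le_ncard hsub (Set.toFinite _)).trans
        ((Set.ncard_biUnion_le_mul F _ fun f _ => hs i f).trans (Nat.mul_le_mul_right s ?_))
      exact hF.trans (Nat.pow_le_pow_right hN (by omega))
  -- hubs of high levels are all on the same level
  have h3 : {x ∈ Z | L + w ≤ lev x}.ncard ≤ s := by
    rcases Set.eq_empty_or_nonempty {x ∈ Z | L + w ≤ lev x} with he | ⟨x, hx, hxl⟩
    · simp [he]
    · have key : ∀ a ∈ Z, ∀ b ∈ Z, L + w ≤ lev b → ¬ lev a < lev b := by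
        intro a ha b hb hbl hab
        have h4 := (hR.exists_eq_of_mem_X (hZX hb)).2 _ (hubLevel_spec (hZX ha)).1 hab a
          (hubLevel_spec (hZX ha)).2.2
        have h5 : P.G.dist a v ≤ _ := hZ ha
        have h6 : P.G.dist b v ≤ _ := hZ hb
        have h7 := hP.dist_triangle b v a
        rw [P.G.dist_comm v a] at h7
        have h8 := mul_le_mul_of_nonneg_left (hP.r_mono hbl) hP.ε_pos.le
        rw [Setup.Admissible.r_add] at h8
        have h9 := mul_le_mul_of_nonneg_right hw (hP.r_pos L).le
        rw [← hlev] at h4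
        nlinarith
      refine le_trans (Set.ncard_le_ncard ?_ (Set.toFinite _)) (hone (lev x) (by omega))
      rintro y ⟨hy, hyl⟩
      refine ⟨hy, le_antisymm ?_ ?_⟩
      · exact not_lt.1 (key x hx y hy hyl)
      · exact not_lt.1 (key y hy x hx hxl)
  have hsub : Z ⊆ {x ∈ Z | lev x ≤ m} ∪ (⋃ i ∈ Finset.Ioo m (L + w), {x ∈ Z | lev x = i}) ∪
      {x ∈ Z | L + w ≤ lev x} := by
    intro x hx
    rcases le_or_gt (lev x) m with h | h
    · exact Or.inl (Or.inl ⟨hx, h⟩)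
    rcases le_or_gt (L + w) (lev x) with h' | h'
    · exact Or.inr ⟨hx, h'⟩
    · exact Or.inl (Or.inr (Set.mem_biUnion (Finset.mem_Ioo.2 ⟨h, h'⟩) ⟨hx, rfl⟩))
  refine (Set.ncard_le_ncard hsub (Set.toFinite _)).trans ((Set.ncard_union_le _ _).trans
    ((Nat.add_le_add ((Set.ncard_union_le _ _).trans (Nat.add_le_add h1
      (Set.ncard_biUnion_finset_le_mul _ _ h2))) h3).trans ?_))
  rw [Nat.card_Ioo]
  have h4 : (L + w - m - 1) * (N ^ (L - m) * s) ≤ (L - m + w) * (N ^ (L - m) * s) :=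
    Nat.mul_le_mul_right _ (by omega)
  have h5 : N ^ (L - m) ≤ N ^ (L - m) * s := Nat.le_mul_of_pos_right _ hs1
  have h6 : s ≤ N ^ (L - m) * s := Nat.le_mul_of_pos_left _ hpow
  nlinarith

end Choices

/-! ### The width of the tree decomposition -/

namespace Choices

variable {V : Type*} {R : Choices V} {P : Setup V} {T : Set V} {lam : ℝ} {s W : ℕ}

/-- A bound for the number of approximate core hubs that are far apart relative to the diameter of
the set that contains them. -/
noncomputable def packingNumber (P : Setup V) (lam : ℝ) (s W : ℕ) : ℕ :=
  Setup.coverNumber lam (P.G.highwayDimension P.c) s ^ W * s * (2 * W + 2)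

/-- The assumptions of the packing bounds: sparse covers, and a number `W` of levels that
separates the scales that are compared. -/
structure Scales (P : Setup V) (lam : ℝ) (s W : ℕ) : Prop where
  sparse : ∀ i, P.G.LocallySparse P.c (P.r i) s (P.spc i)
  one_le_s : 1 ≤ s
  one_le_k : 1 ≤ P.G.highwayDimension P.c
  one_le_d : 1 ≤ P.d
  ratio : 32 * P.d ≤ P.ε * (P.c / 4) ^ W
  net : 8 ≤ P.β * (P.c / 4) ^ W

namespace Scales

variable (hS : Scales P lam s W)

include hS

theorem one_le_coverNumber :
    1 ≤ Setup.coverNumber lam (P.G.highwayDimension P.c) s := by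
  unfold Setup.coverNumber
  have := hS.one_le_k
  have h : 0 < (⌈2 / lam⌉₊ + 1) * P.G.highwayDimension P.c * (1 + s) := by positivity
  omega

theorem one_le_packingNumber : 1 ≤ packingNumber P lam s W := by
  unfold packingNumber
  have h1 := hS.one_le_coverNumber
  have h2 := hS.one_le_s
  have h : 0 < Setup.coverNumber lam (P.G.highwayDimension P.c) s ^ W * s * (2 * W + 2) := by
    positivity
  omega

theorem four_le : 4 ≤ P.ε * (P.c / 4) ^ W := by linarith [hS.ratio, hS.one_le_d]

end Scales

namespace ValidAt

variable [Finite V] (hP : P.Admissible lam) (hR : R.ValidAt P T) (hS : Scales P lam s W)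

include hP hR hS

/-- Since `A` is a town on its own level, it contains no core hub of `T` of that level or below, so
the separation hypothesis of the packing bound is vacuous for `m = L = level A`. -/
theorem ncard_hubs_inter_child_le {A : Set V} (hA : P.IsChild A T) :
    (R.X P T ∩ A).ncard ≤ packingNumber P lam s W := by
  have hAT := hP.level_lt hA
  have hAl := Setup.Admissible.isTownOn_level hA.1
  obtain ⟨v, -, hv⟩ := id hAl
  refine (hR.ncard_packing_le hP hS.sparse hS.one_le_s hS.one_le_coverNumber hS.four_le le_rfl
    hAT.le (v := v) Set.inter_subset_left ?_ ?_).trans ?_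
  · intro x hx
    have h1 : P.G.dist x v ≤ P.r (P.level A) := by
      have := hx.2
      rwa [hv] at this
    simp only [WGraph.ball, Set.mem_ofPred_eq]
    linarith [hP.r_pos (P.level A)]
  · intro x hx y hy hxl
    exact absurd hx.2 ((hR.exists_eq_of_mem_X hx.1).1.1.2 _ hxl hAT _ hAl)
  · unfold packingNumber
    rw [Nat.sub_self, pow_zero, one_mul]
    refine Nat.mul_le_mul (Nat.le_mul_of_pos_left _ ?_) (by omega)
    exact Nat.pow_pos hS.one_le_coverNumber

/-- The packing bound is applied at a scale `L` comparable to the diameter, with `W` levels down to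
`m`, where `4 * r m` drops to the separation of the set. -/
theorem ncard_separated_le {C : Set V} {i : ℕ} {δ : ℝ} (hδ : 8 ≤ δ * (P.c / 4) ^ W)
    (hCX : C ⊆ R.X P T) (hdiam : ∀ x ∈ C, ∀ y ∈ C, P.G.dist x y ≤ 2 ^ (i + 1))
    (hsep : ∀ x ∈ C, ∀ y ∈ C, x ≠ y → δ * 2 ^ i < P.G.dist x y) (hT : P.IsTown T) :
    C.ncard ≤ packingNumber P lam s W := by
  classical
  rcases C.eq_empty_or_nonempty with rfl | ⟨v, hv⟩
  · simp
  -- `L` is the first level of scale at least `2 ^ i`, cut off at the level of `T`, where the core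
  -- ends; consecutive scales differ by a factor of at most two.
  obtain ⟨L, hL, hball, hrL⟩ : ∃ L ≤ P.level T, C ⊆ P.G.ball v (2 * P.r L) ∧
      P.r L ≤ 2 * 2 ^ i := by
    have hex : ∃ L, L = P.level T ∨ 2 ^ i ≤ P.r L := ⟨_, Or.inl rfl⟩
    refine ⟨Nat.find hex, Nat.find_min' hex (Or.inl rfl), fun x hx => ?_, ?_⟩
    · simp only [WGraph.ball, Set.mem_ofPred_eq]
      rcases Nat.find_spec hex with h | h
      · rw [h]
        have := hP.dist_le_of_isTownOn (Setup.Admissible.isTownOn_level hT)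
          (hR.X_subset (hCX hx)) (hR.X_subset (hCX hv))
        linarith [hP.r_pos (P.level T)]
      · have := hdiam x hx v hv
        rw [pow_succ'] at this
        linarith
    · rcases hn : Nat.find hex with _ | n
      · rw [Setup.Admissible.r_zero]
        linarith [one_le_pow₀ (one_le_two : (1 : ℝ) ≤ 2) (n := i)]
      · have := Nat.find_min hex (m := n) (by omega)
        push Not at this
        linarith [hP.r_succ_le n, this.2]
  refine (hR.ncard_packing_le hP hS.sparse hS.one_le_s hS.one_le_coverNumber hS.four_le
    (Nat.sub_le L W) hL hCX hball ?_).trans ?_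
  · intro x hx y hy hxl _ hne
    rcases le_or_gt W L with h | h
    · refine lt_of_le_of_lt ?_ (hsep x hx y hy hne)
      have h1 : P.r L = P.r (L - W) * (P.c / 4) ^ W := by
        rw [← Setup.Admissible.r_add, Nat.sub_add_cancel h]
      have h2 : 0 < (P.c / 4) ^ W := pow_pos (by linarith [hP.four_lt_c]) W
      have h3 : (0 : ℝ) < 2 ^ i := by positivity
      refine le_of_mul_le_mul_right ?_ h2
      nlinarith
    -- Here `L - W` truncates to `0`, and no hub has level `0`.
    · have := (hubLevel_spec (hCX hx)).1
      omega
  · unfold packingNumber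
    refine Nat.mul_le_mul (Nat.mul_le_mul_right _ ?_) (by omega)
    exact Nat.pow_le_pow_right hS.one_le_coverNumber (by omega)

theorem ncard_net_le (hT : P.IsTown T) {i : ℕ} (hi : i ≤ R.top P T) {y : V} (hy : y ∈ R.Y P T) :
    (R.net T i (R.cl T i y)).ncard ≤ packingNumber P lam s W := by
  obtain ⟨h1, -, h3⟩ := hR.isNet i hi y hy
  refine hR.ncard_separated_le hP hS (i := i) hS.net (fun x hx => ?_) (fun x hx z hz => ?_) h3 hT
  · exact hR.Y_subset_X (hR.splitTree.subset i hi y hy (h1 hx))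
  · exact hR.splitTree.diam_le i hi y hy x (h1 hx) z (h1 hz)

/-- One factor counts the net, the other the hubs represented by one net vertex, all of which lie in
its child town. -/
theorem ncard_coreBag_le (hT : P.IsTown T) {i : ℕ} {C : Set V} (hC : R.IsCoreName P T i C) :
    (R.coreBag P T i C).ncard ≤ packingNumber P lam s W * packingNumber P lam s W := by
  obtain ⟨-, hi, y, hy, rfl⟩ := hC
  have hsub : R.coreBag P T i (R.cl T i y) ⊆
      ⋃ z ∈ R.net T i (R.cl T i y), {x ∈ R.X P T | R.rep T x = z} := fun x hx =>
    Set.mem_biUnion hx.2 ⟨hx.1, rfl⟩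
  refine (Set.ncard_le_ncard hsub (Set.toFinite _)).trans ((Set.ncard_biUnion_le_mul _ _
    fun z hz => ?_).trans (Nat.mul_le_mul_right _ (hR.ncard_net_le hP hS hT hi hy)))
  have hzX : z ∈ R.X P T :=
    hR.Y_subset_X (hR.splitTree.subset i hi y hy ((hR.isNet i hi y hy).1 hz))
  obtain ⟨A, hA, hzA⟩ := hR.exists_child_of_mem_X hP hT hzX
  refine (Set.ncard_le_ncard ?_ (Set.toFinite _)).trans (hR.ncard_hubs_inter_child_le hP hS hA)
  rintro x ⟨hx, rfl⟩
  obtain ⟨B, hB, hxB⟩ := hR.exists_child_of_mem_X hP hT hx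
  exact ⟨hx, hP.child_unique hB hA (hR.rep_child B hB x hx hxB) hzA ▸ hxB⟩

omit hR hS in
/-- The distance of two child towns exceeds the scale of the sibling level. -/
theorem r_siblingLevel_lt {A B : Set V} (hA : P.IsChild A T) (hB : P.IsChild B T) (hne : B ≠ A)
    {u w : V} (hu : u ∈ A) (hw : w ∈ B) : P.r (P.siblingLevel T A) < P.G.dist u w := by
  have hdisj : ∀ D, P.IsChild D T → D ≠ A → ∀ a ∈ A, ∀ b ∈ D, a ≠ b := by
    rintro D hD hDA a ha _ hb rfl
    exact hDA (hP.child_unique hD hA hb ha)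
  have hfin : {x | ∃ B, P.IsChild B T ∧ B ≠ A ∧ x = P.G.setDist A B}.Finite := by
    refine (Set.finite_range fun B => P.G.setDist A B).subset ?_
    rintro _ ⟨B, -, -, rfl⟩
    exact ⟨B, rfl⟩
  have hmem : P.G.setDist A B ∈ {x | ∃ B, P.IsChild B T ∧ B ≠ A ∧ x = P.G.setDist A B} :=
    ⟨B, hB, hne, rfl⟩
  have hle : P.siblingDist T A ≤ P.G.dist u w :=
    (csInf_le hfin.bddBelow hmem).trans (WGraph.setDist_le_dist hP.pos hu hw)
  refine lt_of_lt_of_le ?_ hle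
  -- Minimality gives no lower bound at level `0`; there the least distance, above `2`, takes over.
  rcases hn : P.siblingLevel T A with _ | n
  · obtain ⟨D, hD, hDA, h⟩ := Set.Nonempty.csInf_mem ⟨_, hmem⟩ hfin
    obtain ⟨a, ha, b, hb, hab⟩ := WGraph.exists_dist_eq_setDist (G := P.G)
      (hP.nonempty_of_isTown hA.1) (hP.nonempty_of_isTown hD.1)
    have := hP.two_lt_dist (hdisj D hD hDA a ha b hb)
    rw [Setup.Admissible.r_zero]
    change 1 < sInf _
    rw [h, hab]
    linarith
  · by_contra hlt
    have := Nat.sInf_le (s := {i | P.siblingDist T A ≤ P.r (i + 1)}) (not_lt.1 hlt)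
    change P.siblingLevel T A ≤ n at this
    omega

omit [Finite V] hR in
/-- The scale of the sibling level is not much smaller than that of the connecting bag. -/
theorem two_pow_connLevel_le {A : Set V} (h0 : R.connLevel P T A ≠ 0) :
    P.ε / (4 * P.d) * 2 ^ R.connLevel P T A ≤ P.r (P.siblingLevel T A) := by
  set ρ := P.r (P.siblingLevel T A) with hρdef
  have hρ : 0 < ρ := hP.r_pos _
  have hd : 0 < P.d := by linarith [hS.one_le_d]
  have hε := hP.ε_pos
  -- A nonzero level means that `toNat` did not truncate. The two ceilings cost the factor `4` in
  -- the final estimate.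
  have h1 : (R.connLevel P T A : ℤ) ≤ ⌈Real.logb 2 ρ⌉ +
      ⌈Real.logb 2 (1 / P.ε) + Real.logb 2 P.d⌉ := by
    have h2 : R.connLevel P T A ≤ (⌈Real.logb 2 ρ⌉ +
      ⌈Real.logb 2 (1 / P.ε) + Real.logb 2 P.d⌉).toNat := min_le_right _ _
    omega
  have h2 : (R.connLevel P T A : ℝ) ≤ Real.logb 2 (4 * ρ * P.d / P.ε) := by
    have h3 : (R.connLevel P T A : ℝ) ≤ (⌈Real.logb 2 ρ⌉ : ℝ) +
        (⌈Real.logb 2 (1 / P.ε) + Real.logb 2 P.d⌉ : ℝ) := by exact_mod_cast h1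
    have h4 := (Int.ceil_lt_add_one (Real.logb 2 ρ)).le
    have h5 := (Int.ceil_lt_add_one (Real.logb 2 (1 / P.ε) + Real.logb 2 P.d)).le
    have h6 : Real.logb 2 (4 * ρ * P.d / P.ε) =
        2 + Real.logb 2 ρ + (Real.logb 2 (1 / P.ε) + Real.logb 2 P.d) := by
      rw [show 4 * ρ * P.d / P.ε = 2 ^ 2 * ρ * ((1 / P.ε) * P.d) by field_simp; norm_num,
        Real.logb_mul (by positivity) (by positivity), Real.logb_mul (by positivity) hρ.ne',
        Real.logb_mul (by positivity) hd.ne', Real.logb_pow, Real.logb_self_eq_one (by norm_num)]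
      norm_num
    linarith
  rw [Real.le_logb_iff_rpow_le (by norm_num) (by positivity), Real.rpow_natCast] at h2
  rw [div_mul_eq_mul_div, div_le_iff₀ (by positivity)]
  rw [le_div_iff₀ hε] at h2
  linarith

/-- The number of child towns with hubs whose connecting bag is on level `l` above a cluster. -/
theorem ncard_children_le (hT : P.IsTown T) {i l : ℕ} {y : V} (hy : y ∈ R.Y P T) (hil : i ≤ l) :
    {A | P.IsChild A T ∧ R.connLevel P T A = l ∧ R.cl T i y ⊆ R.connCluster P T A ∧
      (R.X P T ∩ A).Nonempty}.ncard ≤ packingNumber P lam s W := by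
  set 𝒜 := {A | P.IsChild A T ∧ R.connLevel P T A = l ∧ R.cl T i y ⊆ R.connCluster P T A ∧
      (R.X P T ∩ A).Nonempty} with h𝒜
  rcases 𝒜.eq_empty_or_nonempty with he | ⟨A₀, hA₀⟩
  · simp [he]
  have hl : l ≤ R.top P T := hA₀.2.1 ▸ connLevel_le A₀
  -- The child towns are counted by their representatives, which all lie in the same cluster of
  -- level `l` and are separated by the distance to the closest sibling.
  have hmem : ∀ A ∈ 𝒜, R.rep T (R.hub T A) ∈ A := by
    rintro A ⟨hA, -, -, x, hx⟩
    rw [hR.rep_hub_eq hP hA hx]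
    exact hR.rep_child A hA x hx.1 hx.2
  have hcl : ∀ A ∈ 𝒜, R.rep T (R.hub T A) ∈ R.cl T l y := by
    rintro A ⟨hA, rfl, hsub, -⟩
    rw [(hR.cl_subset_connCluster_iff hA hil hy).1 hsub]
    exact hR.mem_cl (connLevel_le A) (hR.rep_hub_mem_Y hA)
  have hinj : Set.InjOn (fun A => R.rep T (R.hub T A)) 𝒜 := by
    intro A hA B hB hAB
    have h := hmem B hB
    rw [← (show R.rep T (R.hub T A) = R.rep T (R.hub T B) from hAB)] at h
    exact hP.child_unique hA.1 hB.1 (hmem A hA) h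
  rw [← hinj.ncard_image]
  have hδ : 8 ≤ P.ε / (4 * P.d) * (P.c / 4) ^ W := by
    have hd : 0 < P.d := by linarith [hS.one_le_d]
    rw [div_mul_eq_mul_div, le_div_iff₀ (by positivity)]
    linarith [hS.ratio]
  refine hR.ncard_separated_le hP hS (i := l) hδ ?_ ?_ ?_ hT
  · rintro _ ⟨A, hA, rfl⟩
    exact hR.Y_subset_X (hR.rep_hub_mem_Y hA.1)
  · rintro _ ⟨A, hA, rfl⟩ _ ⟨B, hB, rfl⟩
    exact hR.splitTree.diam_le l hl y hy _ (hcl A hA) _ (hcl B hB)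
  · rintro _ ⟨A, hA, rfl⟩ _ ⟨B, hB, rfl⟩ hne
    have hBA : B ≠ A := by
      rintro rfl
      exact hne rfl
    -- On level `0` the common cluster is a single vertex, which cannot hold two representatives.
    have h0 : R.connLevel P T A ≠ 0 := by
      intro h
      rw [hA.2.1] at h
      have h1 := hcl A hA
      have h2 := hcl B hB
      rw [h, hR.splitTree.lowest y hy, Set.mem_singleton_iff] at h1 h2
      exact hne (h1.trans h2.symm)
    have h3 := two_pow_connLevel_le hP hS h0
    rw [hA.2.1] at h3
    exact h3.trans_lt (r_siblingLevel_lt hP hA.1 hB.1 hBA (hmem A hA) (hmem B hB))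

/-- The three factors count the levels of connecting bags above `C`, the child towns connected on
one such level, and the hubs in one child town. -/
theorem ncard_addedHubs_le (hT : P.IsTown T) {i : ℕ} {C : Set V} (hC : R.IsCoreName P T i C) :
    {v | ∃ A, P.IsChild A T ∧ i ≤ R.connLevel P T A ∧ C ⊆ R.connCluster P T A ∧
      v ∈ R.X P T ∩ A}.ncard ≤
      (R.top P T + 1) * (packingNumber P lam s W * packingNumber P lam s W) := by
  obtain ⟨-, hi, y, hy, rfl⟩ := hC
  have hsub : {v | ∃ A, P.IsChild A T ∧ i ≤ R.connLevel P T A ∧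
      R.cl T i y ⊆ R.connCluster P T A ∧ v ∈ R.X P T ∩ A} ⊆
      ⋃ l ∈ Finset.Icc i (R.top P T), ⋃ A ∈ {A | P.IsChild A T ∧ R.connLevel P T A = l ∧
        R.cl T i y ⊆ R.connCluster P T A ∧ (R.X P T ∩ A).Nonempty}, R.X P T ∩ A := by
    rintro v ⟨A, hA, h1, h2, hv⟩
    exact Set.mem_biUnion (Finset.mem_Icc.2 ⟨h1, connLevel_le A⟩)
      (Set.mem_biUnion ⟨hA, rfl, h2, v, hv⟩ hv)
  refine (Set.ncard_le_ncard hsub (Set.toFinite _)).trans ((Set.ncard_biUnion_finset_le_mul _ _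
    fun l hl => ?_).trans (Nat.mul_le_mul_right _ ?_))
  · refine (Set.ncard_biUnion_le_mul _ _ fun A hA =>
      hR.ncard_hubs_inter_child_le hP hS hA.1).trans (Nat.mul_le_mul_right _ ?_)
    exact hR.ncard_children_le hP hS hT hy (Finset.mem_Icc.1 hl).1
  · rw [Nat.card_Icc]
    omega

end ValidAt

variable [Finite V] (hP : P.Admissible lam) (hR : R.Valid P) (hS : Scales P lam s W)

include hP hR

theorem ncard_bag_le_one (hT : P.IsTown T) (h0 : P.level T = 0)
    (n : BagName V) : {v | R.InBag P T n v}.ncard ≤ 1 := by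
  obtain ⟨v, rfl⟩ := hP.exists_eq_singleton hT h0
  rw [← Set.ncard_singleton v]
  exact Set.ncard_le_ncard (fun u hu => (hu.isName_and_mem hP hR hT).2) (Set.toFinite _)

include hS

/-- A bag of a child town gains only the connecting bag and the hubs inside the child, while the
level rises by at least one. A core bag starts afresh. Both cost at most `(t + 3) * F ^ 2`. -/
theorem ncard_bag_le {t : ℕ} (ht : ∀ T, R.top P T ≤ t) (hT : P.IsTown T) :
    ∀ n : BagName V, {v | R.InBag P T n v}.ncard ≤
      1 + P.level T * ((t + 3) * (packingNumber P lam s W * packingNumber P lam s W)) := by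
  induction hT using hP.town_induction with
  | h T hT ih =>
    intro n
    by_cases h0 : P.level T = 0
    · exact (ncard_bag_le_one hP hR hT h0 n).trans (Nat.le_add_right _ _)
    by_cases hn : R.IsName P T n
    swap
    · have : {v | R.InBag P T n v} = ∅ :=
        Set.eq_empty_of_forall_notMem fun v hv => hn (InBag.isName_and_mem hP hR hT hv).1
      simp [this]
    have hval := hR T hT h0
    set F := packingNumber P lam s W with hF
    have hF1 : 1 ≤ F := hS.one_le_packingNumber
    rcases hn.cases_of_level_ne_zero h0 with ⟨i, C, rfl, hC⟩ | ⟨A, hA, hnA⟩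
    · have hsub : {v | R.InBag P T (T, i, C) v} ⊆ R.coreBag P T i C ∪
          {v | ∃ A, P.IsChild A T ∧ i ≤ R.connLevel P T A ∧ C ⊆ R.connCluster P T A ∧
            v ∈ R.X P T ∩ A} := fun v hv => InBag.of_core hP hR h0 hv
      refine (Set.ncard_le_ncard hsub (Set.toFinite _)).trans ((Set.ncard_union_le _ _).trans
        ((Nat.add_le_add (hval.ncard_coreBag_le hP hS hT hC)
          (hval.ncard_addedHubs_le hP hS hT hC)).trans ?_))
      have h1 : (R.top P T + 1) * (F * F) ≤ (t + 1) * (F * F) :=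
        Nat.mul_le_mul_right _ (by linarith [ht T])
      have h2 : (t + 3) * (F * F) ≤ P.level T * ((t + 3) * (F * F)) :=
        Nat.le_mul_of_pos_left _ (Nat.pos_of_ne_zero h0)
      nlinarith
    · have hsub : {v | R.InBag P T n v} ⊆ {v | R.InBag P A n v} ∪ R.connBag P T A ∪
          (R.X P T ∩ A) := by
        intro v hv
        rcases InBag.of_child hP hR hA hnA hv with h | h | h
        · exact Or.inl (Or.inl h)
        · exact Or.inl (Or.inr h)
        · exact Or.inr h
      refine (Set.ncard_le_ncard hsub (Set.toFinite _)).trans ((Set.ncard_union_le _ _).trans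
        ((Nat.add_le_add ((Set.ncard_union_le _ _).trans (Nat.add_le_add (ih A hA n)
          (hval.ncard_coreBag_le hP hS hT (hval.isCoreName_conn hP hA))))
            (hval.ncard_hubs_inter_child_le hP hS hA)).trans ?_))
      have h1 : (P.level A + 1) * ((t + 3) * (F * F)) ≤ P.level T * ((t + 3) * (F * F)) :=
        Nat.mul_le_mul_right _ (hP.level_lt hA)
      have h2 : F ≤ F * F := Nat.le_mul_of_pos_left _ hF1
      nlinarith

end Choices

/-! ### Estimates -/

namespace Estimates

/-- From `log x ≥ 1 - 1 / x` the base has logarithm at least `lam / (4 + lam) ≥ lam / 8`. -/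
theorem le_pow_of_log_le {lam y : ℝ} (h0 : 0 < lam) (h4 : lam ≤ 4) (hy : 0 < y) {n : ℕ}
    (h : 8 * Real.log y / lam ≤ n) : y ≤ ((4 + lam) / 4) ^ n := by
  have h1 : 0 < (4 + lam) / 4 := by linarith
  have h2 : lam / 8 ≤ Real.log ((4 + lam) / 4) := by
    refine le_trans ?_ (Real.one_sub_inv_le_log_of_pos h1)
    rw [inv_div, le_sub_iff_add_le, ← le_sub_iff_add_le', div_le_iff₀ (by linarith)]
    nlinarith
  rw [← Real.log_le_log_iff hy (pow_pos h1 n), Real.log_pow]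
  rw [div_le_iff₀ h0] at h
  have h3 := mul_le_mul_of_nonneg_left h2 (Nat.cast_nonneg (α := ℝ) n)
  linarith

/-- Since `α ≥ 1`, the base `log (2 + α)` of the bounds is at least `log 3`, and its logarithm is
bounded below by a positive constant. -/
theorem one_lt_log_three : 1 < Real.log 3 := by
  rw [Real.lt_log_iff_exp_lt (by norm_num)]
  exact Real.exp_one_lt_d9.trans (by norm_num)

/-- The quantities that the bounds are made of. -/
structure Input (k s : ℕ) (lam ε α : ℝ) : Prop where
  k_pos : 1 ≤ k
  s_pos : 1 ≤ s
  lam_pos : 0 < lam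
  lam_le : lam ≤ 4
  ε_pos : 0 < ε
  ε_le : ε ≤ 1
  α_ge : 1 ≤ α

namespace Input

variable {k s : ℕ} {lam ε α : ℝ} (I : Input k s lam ε α)

include I

theorem one_lt_log : 1 < Real.log (2 + α) :=
  one_lt_log_three.trans_le (Real.log_le_log (by norm_num) (by linarith [I.α_ge]))

theorem loglog_ge : Real.log (Real.log 3) ≤ Real.log (Real.log (2 + α)) :=
  Real.log_le_log (by linarith [one_lt_log_three])
    (Real.log_le_log (by norm_num) (by linarith [I.α_ge]))

omit I in
theorem half_le_log {y : ℝ} (hy : 0 ≤ y) : 1 / 2 ≤ Real.log (2 + y) := by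
  have : Real.log 2 ≤ Real.log (2 + y) := Real.log_le_log (by norm_num) (by linarith)
  linarith [Real.log_two_gt_d9]

theorem ratio_ge {y : ℝ} (hy : 1 ≤ y) : 1 / ε ≤ 4 * (y / (ε * lam)) ∧
    1 / lam ≤ y / (ε * lam) ∧ y / lam ≤ y / (ε * lam) ∧ y ≤ 4 * (y / (ε * lam)) := by
  have hl := I.lam_pos
  have hε := I.ε_pos
  have h1 : ε * lam ≤ 4 := by nlinarith [I.ε_le, I.lam_le]
  have h2 : ε * lam ≤ lam := by nlinarith [I.ε_le]
  have h0 : 0 < ε * lam := by positivity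
  refine ⟨?_, ?_, ?_, ?_⟩
  · rw [← mul_div_assoc, div_le_div_iff₀ hε h0]
    nlinarith [I.lam_le]
  · rw [div_le_div_iff₀ hl h0]
    nlinarith
  · exact div_le_div_of_nonneg_left (by linarith) h0 h2
  · rw [← mul_div_assoc, le_div_iff₀ h0]
    nlinarith

/-- The bound for the parameter `d`. -/
theorem log_d_le {κ d : ℝ} (hκ : 0 < κ) (hd1 : 1 ≤ d)
    (hd : d ≤ κ * Real.log (2 + k * s * Real.log (2 + 1 / ε) / lam) / lam) :
    Real.log d ≤ Real.log (1 + 3 * κ) + 2 * Real.log (2 + k * s / (ε * lam)) := by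
  have hl := I.lam_pos
  have hε := I.ε_pos
  have hks : (1 : ℝ) ≤ k * s := by exact_mod_cast Nat.mul_pos I.k_pos I.s_pos
  obtain ⟨-, h3, -, -⟩ := I.ratio_ge hks
  set y : ℝ := k * s / (ε * lam) with hy
  have hy0 : 0 < y := by positivity
  have h4 : Real.log (2 + 1 / ε) ≤ 2 / ε := by
    refine (Real.log_le_sub_one_of_pos (by positivity)).trans ?_
    have : 1 ≤ 1 / ε := by rw [le_div_iff₀ hε]; linarith [I.ε_le]
    rw [show 2 / ε = 1 / ε + 1 / ε by ring]
    linarith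
  have h5 : k * s * Real.log (2 + 1 / ε) / lam ≤ 2 * y := by
    calc k * s * Real.log (2 + 1 / ε) / lam ≤ k * s * (2 / ε) / lam := by gcongr
      _ = 2 * y := by rw [hy]; field_simp
  have h7 : 0 ≤ k * s * Real.log (2 + 1 / ε) / lam := by
    have : 0 ≤ Real.log (2 + 1 / ε) := Real.log_nonneg (by
      have : 0 < 1 / ε := by positivity
      linarith)
    positivity
  have h6 : Real.log (2 + k * s * Real.log (2 + 1 / ε) / lam) ≤ 3 * (2 + y) := by
    refine (Real.log_le_sub_one_of_pos (by linarith)).trans ?_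
    linarith
  have h8 : d ≤ (1 + 3 * κ) * (2 + y) ^ 2 := by
    calc d ≤ κ * Real.log (2 + k * s * Real.log (2 + 1 / ε) / lam) * (1 / lam) := by
            rw [mul_one_div]; exact hd
      _ ≤ κ * (3 * (2 + y)) * (2 + y) := by
            gcongr
            linarith
      _ ≤ (1 + 3 * κ) * (2 + y) ^ 2 := by nlinarith [sq_nonneg (2 + y)]
  refine (Real.log_le_log (by linarith) h8).trans (le_of_eq ?_)
  rw [Real.log_mul (by positivity) (by positivity), Real.log_pow]
  norm_num

theorem log_coverNumber_le : Real.log (Setup.coverNumber lam k s) ≤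
    6 * Real.log (2 + k * s / (ε * lam)) := by
  have hl := I.lam_pos
  have hε := I.ε_pos
  have hk : (1 : ℝ) ≤ k := by exact_mod_cast I.k_pos
  have hs : (1 : ℝ) ≤ s := by exact_mod_cast I.s_pos
  have hks : (1 : ℝ) ≤ k * s := by nlinarith
  obtain ⟨-, -, h4, -⟩ := I.ratio_ge hks
  set y : ℝ := k * s / (ε * lam) with hy
  have hy0 : 0 < y := by positivity
  have h1 : (⌈2 / lam⌉₊ : ℝ) ≤ 2 / lam + 1 := (Nat.ceil_lt_add_one (by positivity)).le
  have h2 : 1 ≤ 4 / lam := by rw [le_div_iff₀ hl]; linarith [I.lam_le]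
  have h3 : ((Setup.coverNumber lam k s : ℕ) : ℝ) ≤ 2 ^ 5 * (2 + y) := by
    unfold Setup.coverNumber
    push_cast
    calc ((⌈2 / lam⌉₊ : ℝ) + 1) * k * (1 + s) ≤ (10 / lam) * k * (2 * s) := by
          gcongr
          · rw [show 10 / lam = 2 / lam + 2 * (4 / lam) by ring]
            linarith
          · linarith
      _ = 20 * (k * s / lam) := by ring
      _ ≤ 2 ^ 5 * (2 + y) := by nlinarith
  have h5 : 0 < Setup.coverNumber lam k s := by
    have := I.k_pos
    unfold Setup.coverNumber
    positivity
  refine (Real.log_le_log (by exact_mod_cast h5) h3).trans ?_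
  rw [Real.log_mul (by positivity) (by positivity), Real.log_pow]
  have : Real.log 2 ≤ Real.log (2 + y) := Real.log_le_log (by norm_num) (by linarith)
  push_cast
  linarith

theorem log_packing_le (W : ℕ) :
    Real.log ((Setup.coverNumber lam k s ^ W * s * (2 * W + 2) : ℕ) : ℝ) ≤
      10 * Real.log (2 + k * s / (ε * lam)) * (W + 1) := by
  have hl := I.lam_pos
  have hε := I.ε_pos
  have hk : (1 : ℝ) ≤ k := by exact_mod_cast I.k_pos
  have hs : (1 : ℝ) ≤ s := by exact_mod_cast I.s_pos
  have hks : (1 : ℝ) ≤ k * s := by nlinarith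
  have hN := I.log_coverNumber_le
  obtain ⟨-, -, -, h5⟩ := I.ratio_ge hks
  have hN0 : (0 : ℝ) < Setup.coverNumber lam k s := by
    have := I.k_pos
    unfold Setup.coverNumber
    positivity
  set y : ℝ := k * s / (ε * lam) with hy
  have hy0 : 0 < y := by positivity
  have hq := Input.half_le_log hy0.le
  have hlog2 : Real.log 2 ≤ Real.log (2 + y) := Real.log_le_log (by norm_num) (by linarith)
  have h6 : Real.log s ≤ 3 * Real.log (2 + y) := by
    have : (s : ℝ) ≤ 2 ^ 2 * (2 + y) := by nlinarith
    refine (Real.log_le_log (by linarith) this).trans ?_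
    rw [Real.log_mul (by positivity) (by positivity), Real.log_pow]
    push_cast
    linarith
  have h7 : Real.log (2 * W + 2) ≤ (2 * W + 1) * (2 * Real.log (2 + y)) := by
    refine (Real.log_le_sub_one_of_pos (by positivity)).trans ?_
    have : (0 : ℝ) ≤ W := W.cast_nonneg
    nlinarith
  push_cast
  rw [Real.log_mul (by positivity) (by positivity), Real.log_mul (by positivity) (by positivity),
    Real.log_pow]
  have h8 := mul_le_mul_of_nonneg_left hN (Nat.cast_nonneg (α := ℝ) W)
  have : (0 : ℝ) ≤ W := W.cast_nonneg
  nlinarith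

end Input

/-- Here `l = log log (2 + α)`, `q = log (2 + k s / (ε λ))` and `u = 1 / λ`. Their positive lower
bounds let every term be charged to `l * q ^ 2 * u`; terms without `l` cost a factor `1 / l₀`. -/
theorem absorb_width {l₀ l q u C : ℝ} (hl₀ : 0 < l₀) (hl : l₀ ≤ l) (hq : 1 / 2 ≤ q)
    (hu : 1 / 4 ≤ u) (hC : 0 < C) : 3 + l + 160 * q * u * (C + 8 * q + l) ≤
      ((48 + 320 * C + 1280) / l₀ + 336) * (l * (q ^ 2 * u)) := by
  have hu0 : 0 < u := by linarith
  have hq2 : q ≤ 2 * q ^ 2 := by nlinarith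
  set m := q ^ 2 * u with hm
  have e1 : 1 / 4 * u ≤ m := mul_le_mul_of_nonneg_right (by nlinarith) hu0.le
  have e2 : q * u ≤ 2 * m := by
    rw [hm, ← mul_assoc]
    exact mul_le_mul_of_nonneg_right hq2 hu0.le
  have hm0 : 0 < m := by linarith
  set p := l / l₀ with hp
  have hp1 : 1 ≤ p := by rw [hp, le_div_iff₀ hl₀]; linarith
  have hrhs : ((48 + 320 * C + 1280) / l₀ + 336) * (l * m) =
      48 * (p * m) + 320 * (C * (p * m)) + 1280 * (p * m) + 336 * (l * m) := by
    rw [hp]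
    field_simp
  have e3 : m ≤ p * m := le_mul_of_one_le_left hm0.le hp1
  have e5 : q * u * C ≤ 2 * (C * (p * m)) := by
    have := mul_le_mul_of_nonneg_right (e2.trans (by linarith : 2 * m ≤ 2 * (p * m))) hC.le
    linarith
  have e6 : q * u * l ≤ 2 * (l * m) := by
    have := mul_le_mul_of_nonneg_right e2 (hl₀.le.trans hl)
    linarith
  have e7 : 1 / 16 * l ≤ l * m := by
    rw [mul_comm]
    exact mul_le_mul_of_nonneg_left (by linarith) (hl₀.le.trans hl)
  have e8 : 160 * q * u * (C + 8 * q + l) =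
      160 * (q * u * C) + 1280 * m + 160 * (q * u * l) := by
    rw [hm]
    ring
  rw [hrhs, e8]
  linarith

theorem absorb_levels {l₀ l q u : ℝ} (hl₀ : 0 < l₀) (hl : l₀ ≤ l) (hq : 1 / 2 ≤ q)
    (hu : 1 / 4 ≤ u) : 4 + l + q ≤ (72 / l₀ + 16) * (l * (q ^ 2 * u)) := by
  have hu0 : 0 < u := by linarith
  have hq2 : q ≤ 2 * q ^ 2 := by nlinarith
  set m := q ^ 2 * u with hm
  have e1 : 1 / 4 * u ≤ m := mul_le_mul_of_nonneg_right (by nlinarith) hu0.le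
  have e2 : q * u ≤ 2 * m := by
    rw [hm, ← mul_assoc]
    exact mul_le_mul_of_nonneg_right hq2 hu0.le
  have hm0 : 0 < m := by linarith
  set p := l / l₀ with hp
  have hp1 : 1 ≤ p := by rw [hp, le_div_iff₀ hl₀]; linarith
  have hrhs : (72 / l₀ + 16) * (l * m) = 72 * (p * m) + 16 * (l * m) := by
    rw [hp]
    field_simp
  have e3 : m ≤ p * m := le_mul_of_one_le_left hm0.le hp1
  have e4 : q * (1 / 4) ≤ q * u := mul_le_mul_of_nonneg_left hu (by linarith)
  have e7 : 1 / 16 * l ≤ l * m := by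
    rw [mul_comm]
    exact mul_le_mul_of_nonneg_left (by linarith) (hl₀.le.trans hl)
  rw [hrhs]
  linarith

theorem Input.log_top_le {k s : ℕ} {lam ε α : ℝ} (I : Input k s lam ε α) {t : ℕ}
    (ht : (t : ℝ) ≤ Real.logb 2 α + 4) :
    Real.log (t + 3) ≤ 3 + Real.log (Real.log (2 + α)) := by
  have ha := I.one_lt_log
  set a := Real.log (2 + α)
  have h1 : Real.logb 2 α ≤ 2 * a := by
    have h2 : Real.log α ≤ a := Real.log_le_log (by linarith [I.α_ge]) (by linarith)
    have h3 := Real.log_two_gt_d9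
    rw [Real.logb, div_le_iff₀ (by linarith)]
    nlinarith
  have h4 : (t : ℝ) + 3 ≤ 9 * a := by linarith
  have h5 : Real.log 9 ≤ 3 := by
    rw [show (9 : ℝ) = 3 ^ 2 by norm_num, Real.log_pow]
    have : Real.log 3 ≤ 3 / 2 := by
      rw [Real.log_le_iff_le_exp (by norm_num)]
      have := Real.quadratic_le_exp_of_nonneg (show (0 : ℝ) ≤ 3 / 2 by norm_num)
      linarith
    push_cast
    linarith
  refine (Real.log_le_log (by positivity) h4).trans ?_
  rw [Real.log_mul (by norm_num) (by positivity)]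
  linarith

/-- The constant in the bound for the number of levels that separate the compared scales. -/
noncomputable def levelConst (κ b : ℝ) : ℝ :=
  Real.log 32 + Real.log (1 + 1 / b) + Real.log (1 + 3 * κ) + 1

theorem levelConst_pos {κ b : ℝ} (hκ : 0 < κ) (hb : 0 < b) : 0 < levelConst κ b := by
  have h1 : 0 ≤ Real.log 32 := Real.log_nonneg (by norm_num)
  have h2 : 0 ≤ Real.log (1 + 1 / b) := Real.log_nonneg (by
    have : 0 < 1 / b := by positivity
    linarith)
  have h3 : 0 ≤ Real.log (1 + 3 * κ) := Real.log_nonneg (by linarith)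
  unfold levelConst
  linarith

/-- Few levels separate the scales that are compared. -/
theorem Input.exists_levels {k s : ℕ} {lam ε α : ℝ} (I : Input k s lam ε α) {κ b d β : ℝ}
    (hκ : 0 < κ) (hb : 0 < b) (hd1 : 1 ≤ d)
    (hd : d ≤ κ * Real.log (2 + k * s * Real.log (2 + 1 / ε) / lam) / lam)
    (hβ : b * (ε ^ 2 / (d * Real.log (2 + α))) ≤ β) :
    ∃ W : ℕ, 32 * d ≤ ε * ((4 + lam) / 4) ^ W ∧ 8 ≤ β * ((4 + lam) / 4) ^ W ∧
      (W : ℝ) + 1 ≤ 8 * (1 / lam) * (levelConst κ b + 8 * Real.log (2 + k * s / (ε * lam)) +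
        Real.log (Real.log (2 + α))) := by
  have hl := I.lam_pos
  have hε := I.ε_pos
  have hks : (1 : ℝ) ≤ k * s := by exact_mod_cast Nat.mul_pos I.k_pos I.s_pos
  have ha := I.one_lt_log
  have hdlog := I.log_d_le hκ hd1 hd
  obtain ⟨h1ε, -, -, -⟩ := I.ratio_ge hks
  set a := Real.log (2 + α) with ha_def
  set y : ℝ := k * s / (ε * lam) with hy
  have hy0 : 0 < y := by positivity
  set q := Real.log (2 + y) with hq_def
  set l := Real.log a with hl_def
  have hu : 1 / 4 ≤ 1 / lam := one_div_le_one_div_of_le hl I.lam_le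
  have h1b : 0 < 1 / b := by positivity
  -- A single ratio of scales that serves both requirements: it exceeds `32 * d / ε`, and `β * E ≥
  -- 32 * (b + 1)`.
  set E := 32 * (1 + 1 / b) * d * a * (1 / ε) ^ 2 with hE
  have hε1 : 1 ≤ 1 / ε := by rw [le_div_iff₀ hε]; linarith [I.ε_le]
  have hE1 : 32 * d * (1 / ε) ≤ E := by
    have h1 : d * (1 / ε) ≤ (1 + 1 / b) * d * a * (1 / ε) ^ 2 := by
      calc d * (1 / ε) = 1 * d * 1 * (1 / ε) := by ring
        _ ≤ (1 + 1 / b) * d * a * (1 / ε) ^ 2 := by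
          gcongr
          · linarith
          · nlinarith
    rw [hE]
    linarith
  have hEpos : 0 < E := by positivity
  have hElog : Real.log E ≤ levelConst κ b - 1 + 8 * q + l := by
    have h1 : Real.log (1 / ε) ≤ 3 * q := by
      have : 1 / ε ≤ 2 ^ 2 * (2 + y) := by linarith
      refine (Real.log_le_log (by positivity) this).trans ?_
      rw [Real.log_mul (by positivity) (by positivity), Real.log_pow]
      have : Real.log 2 ≤ q := Real.log_le_log (by norm_num) (by linarith)
      push_cast
      linarith
    rw [hE, Real.log_mul (by positivity) (by positivity),
      Real.log_mul (by positivity) (by positivity), Real.log_mul (by positivity) (by positivity),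
      Real.log_mul (by positivity) (by positivity), Real.log_pow]
    unfold levelConst
    push_cast
    linarith
  have hElog0 : 0 ≤ Real.log E := Real.log_nonneg (by nlinarith)
  set W := ⌈8 * Real.log E / lam⌉₊ with hW
  have hpow : E ≤ ((4 + lam) / 4) ^ W := le_pow_of_log_le hl I.lam_le hEpos (Nat.le_ceil _)
  refine ⟨W, ?_, ?_, ?_⟩
  · refine le_trans ?_ (mul_le_mul_of_nonneg_left (hE1.trans hpow) hε.le)
    apply le_of_eq
    field_simp
  · have hβ0 : 0 < b * (ε ^ 2 / (d * a)) := by positivity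
    calc (8 : ℝ) ≤ 32 * (b + 1) := by linarith
      _ = b * (ε ^ 2 / (d * a)) * E := by
          rw [hE]
          field_simp
      _ ≤ β * ((4 + lam) / 4) ^ W := mul_le_mul hβ hpow hEpos.le (hβ0.le.trans hβ)
  · have h1 : (W : ℝ) ≤ 8 * Real.log E / lam + 1 := (Nat.ceil_lt_add_one (by positivity)).le
    have h2 : 8 * Real.log E / lam = 8 * (1 / lam) * Real.log E := by ring
    have h3 := mul_le_mul_of_nonneg_left hElog (by positivity : 0 ≤ 8 * (1 / lam))
    linarith

/-- The width bound. -/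
theorem exists_width_bound {κ b : ℝ} (hκ : 0 < κ) (hb : 0 < b) :
    ∃ K : ℝ, 0 < K ∧ ∀ (k s : ℕ) (lam ε α d β : ℝ), Input k s lam ε α → 1 ≤ d →
      d ≤ κ * Real.log (2 + k * s * Real.log (2 + 1 / ε) / lam) / lam →
      b * (ε ^ 2 / (d * Real.log (2 + α))) ≤ β →
      ∃ W : ℕ, 32 * d ≤ ε * ((4 + lam) / 4) ^ W ∧ 8 ≤ β * ((4 + lam) / 4) ^ W ∧
        ∀ t : ℕ, (t : ℝ) ≤ Real.logb 2 α + 4 →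
          (((t + 3) * ((Setup.coverNumber lam k s ^ W * s * (2 * W + 2)) *
            (Setup.coverNumber lam k s ^ W * s * (2 * W + 2))) : ℕ) : ℝ) ≤
          Real.log (2 + α) ^ (K * Real.log (2 + k * s / (ε * lam)) ^ 2 / lam) := by
  have hl₀ : 0 < Real.log (Real.log 3) := Real.log_pos one_lt_log_three
  have hC := levelConst_pos hκ hb
  refine ⟨(48 + 320 * levelConst κ b + 1280) / Real.log (Real.log 3) + 336, by positivity, ?_⟩
  intro k s lam ε α d β I hd1 hd hβ
  obtain ⟨W, hW1, hW2, hW3⟩ := I.exists_levels hκ hb hd1 hd hβ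
  refine ⟨W, hW1, hW2, fun t ht => ?_⟩
  have hlam := I.lam_pos
  have hε := I.ε_pos
  have ha := I.one_lt_log
  have hF := I.log_packing_le W
  have ht3 := I.log_top_le ht
  have hy0 : 0 ≤ (k : ℝ) * s / (ε * lam) := by positivity
  have hq := Input.half_le_log hy0
  have habs := absorb_width hl₀ I.loglog_ge hq (one_div_le_one_div_of_le hlam I.lam_le) hC
  have hFpos : 0 < Setup.coverNumber lam k s ^ W * s * (2 * W + 2) := by
    have := I.k_pos
    have := I.s_pos
    unfold Setup.coverNumber
    positivity
  generalize Setup.coverNumber lam k s ^ W * s * (2 * W + 2) = F at hF hFpos ⊢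
  generalize Real.log (2 + k * s / (ε * lam)) = q at *
  generalize Real.log (2 + α) = a at *
  have hFpos' : (0 : ℝ) < F := by exact_mod_cast hFpos
  have hpos : (0 : ℝ) < (((t + 3) * (F * F) : ℕ) : ℝ) := by push_cast; positivity
  have hlogM : Real.log (((t + 3) * (F * F) : ℕ) : ℝ) ≤ 3 + Real.log a +
      160 * q * (1 / lam) * (levelConst κ b + 8 * q + Real.log a) := by
    push_cast
    rw [Real.log_mul (by positivity) (by positivity), Real.log_mul hFpos'.ne' hFpos'.ne']
    -- The coefficient `160` is `2 * 10 * 8`: two factors `F`, the bound for `log F`, and the bound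
    -- for `W + 1`.
    have h1 := mul_le_mul_of_nonneg_left hW3 (by linarith : 0 ≤ 10 * q)
    linarith
  rw [Real.rpow_def_of_pos (by linarith), ← Real.log_le_iff_le_exp hpos]
  refine (hlogM.trans habs).trans (le_of_eq ?_)
  ring

/-- The number of levels and the sparsity parameter are absorbed by the bound. -/
theorem exists_final_bound {A : ℝ} (hA : 0 < A) {K : ℝ} (hK : 0 < K) :
    ∃ K' : ℝ, 0 < K' ∧ ∀ (k s j : ℕ) (lam ε α : ℝ), Input k s lam ε α →
      (s : ℝ) ≤ A * (k * Real.log (2 + k)) → (j : ℝ) ≤ 8 * Real.log (8 * α) / lam + 1 →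
      j * Real.log (2 + α) ^ (K * Real.log (2 + k * s / (ε * lam)) ^ 2 / lam) ≤
        Real.log (2 + α) ^ (K' * Real.log (2 + k / (ε * lam)) ^ 2 / lam) := by
  set l₀ := Real.log (Real.log 3) with hl₀
  have hl₀pos : 0 < l₀ := Real.log_pos one_lt_log_three
  -- The bound on `s` makes `k s / (ε λ)` at most `32 A` times the cube of `k / (ε λ)`. The additive
  -- `log (2 + 32 A)` becomes a multiple of `q` because `q ≥ 1 / 2`.
  set C := 2 * Real.log (2 + 32 * A) + 3 with hC
  have hlogA : 0 ≤ Real.log (2 + 32 * A) := Real.log_nonneg (by linarith)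
  refine ⟨72 / l₀ + 16 + K * C ^ 2, by positivity, ?_⟩
  intro k s j lam ε α I hs hj
  have hl := I.lam_pos
  have hε := I.ε_pos
  have hk : (1 : ℝ) ≤ k := by exact_mod_cast I.k_pos
  have ha := I.one_lt_log
  have hll := I.loglog_ge
  obtain ⟨-, hu', -, -⟩ := I.ratio_ge hk
  set a := Real.log (2 + α) with ha_def
  set y : ℝ := k / (ε * lam) with hy
  have hy0 : 0 < y := by positivity
  have hq := Input.half_le_log hy0.le
  set q := Real.log (2 + y) with hq_def
  set l := Real.log a with hl_def
  have hlpos : 0 < l := hl₀pos.trans_le hll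
  set u := 1 / lam with hu_def
  have hu : 1 / 4 ≤ u := one_div_le_one_div_of_le hl I.lam_le
  have hqs : Real.log (2 + k * s / (ε * lam)) ≤ C * q := by
    have h1 : (s : ℝ) ≤ 2 * A * k ^ 2 := by
      have : Real.log (2 + k) ≤ 2 * k :=
        (Real.log_le_sub_one_of_pos (by linarith)).trans (by linarith)
      calc (s : ℝ) ≤ A * (k * Real.log (2 + k)) := hs
        _ ≤ A * (k * (2 * k)) := by gcongr
        _ = 2 * A * k ^ 2 := by ring
    have h2 : (k : ℝ) * s / (ε * lam) ≤ 32 * A * y ^ 3 := by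
      have h3 : ε * lam ≤ 4 := by nlinarith [I.ε_le, I.lam_le]
      have h0 : 0 < ε * lam := by positivity
      calc (k : ℝ) * s / (ε * lam) ≤ k * (2 * A * k ^ 2) / (ε * lam) := by gcongr
        _ = 2 * A * y ^ 3 * (ε * lam) ^ 2 := by rw [hy]; field_simp
        _ ≤ 2 * A * y ^ 3 * 4 ^ 2 := by gcongr
        _ = 32 * A * y ^ 3 := by ring
    have h4 : 2 + (k : ℝ) * s / (ε * lam) ≤ (2 + 32 * A) * (2 + y) ^ 3 := by
      have h5 : y ^ 3 ≤ (2 + y) ^ 3 := by gcongr; linarith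
      have h6 : 1 ≤ (2 + y) ^ 3 := one_le_pow₀ (by linarith)
      nlinarith
    refine (Real.log_le_log (by positivity) h4).trans ?_
    rw [Real.log_mul (by positivity) (by positivity), Real.log_pow]
    push_cast
    nlinarith
  rcases Nat.eq_zero_or_pos j with rfl | hj0
  · simp only [Nat.cast_zero, zero_mul]
    exact Real.rpow_nonneg (by linarith) _
  have hj0' : (0 : ℝ) < j := by exact_mod_cast hj0
  -- The number of levels is `O(log (2 + α) / λ)`, so its logarithm is of lower order and fits into
  -- the exponent.
  have hlogj : Real.log j ≤ 4 + l + q := by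
    have h1 : Real.log (8 * α) ≤ 3 + a := by
      have hα : 0 < α := by linarith [I.α_ge]
      rw [Real.log_mul (by norm_num) hα.ne', show (8 : ℝ) = 2 ^ 3 by norm_num, Real.log_pow]
      have : Real.log α ≤ a := Real.log_le_log hα (by linarith)
      have := Real.log_two_lt_d9
      push_cast
      linarith
    have h2 : (j : ℝ) ≤ 36 * a * (2 + y) := by
      calc (j : ℝ) ≤ 8 * Real.log (8 * α) * u + 1 := by rw [hu_def, mul_one_div]; exact hj
        _ ≤ 8 * (3 + a) * u + 4 * u := by gcongr; linarith
        _ ≤ 36 * a * u := by nlinarith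
        _ ≤ 36 * a * (2 + y) := by gcongr; linarith
    have h3 : Real.log 36 ≤ 4 := by
      rw [Real.log_le_iff_le_exp (by norm_num), show (4 : ℝ) = (4 : ℕ) * 1 by norm_num,
        Real.exp_nat_mul]
      calc (36 : ℝ) ≤ 2.7182818283 ^ 4 := by norm_num
        _ ≤ Real.exp 1 ^ 4 := by gcongr; exact Real.exp_one_gt_d9.le
    refine (Real.log_le_log hj0' h2).trans ?_
    rw [Real.log_mul (by positivity) (by positivity), Real.log_mul (by norm_num) (by positivity)]
    linarith
  have habs := absorb_levels hl₀pos hll hq hu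
  have e0 : l * (K * Real.log (2 + k * s / (ε * lam)) ^ 2 / lam) ≤
      l * (K * (C * q) ^ 2 / lam) := by
    have : 0 ≤ Real.log (2 + k * s / (ε * lam)) := Real.log_nonneg (by
      have : 0 ≤ (k : ℝ) * s / (ε * lam) := by positivity
      linarith)
    gcongr
  rw [Real.rpow_def_of_pos (by linarith), Real.rpow_def_of_pos (by linarith),
    ← Real.exp_log hj0', ← Real.exp_add, Real.exp_le_exp]
  have hrhs : l * ((72 / l₀ + 16 + K * C ^ 2) * q ^ 2 / lam) =
      (72 / l₀ + 16) * (l * (q ^ 2 * u)) + l * (K * (C * q) ^ 2 / lam) := by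
    rw [hu_def]
    ring
  rw [hrhs]
  linarith

end Estimates

/-! ### Bounds in terms of the aspect ratio, and positivity of the parameters -/

namespace WGraph

variable {V : Type*} {G : WGraph V}

theorem diam_nonneg (hpos : ∀ e ∈ G.graph.edgeSet, 0 < G.len e) (S : Set V) : 0 ≤ G.diam S :=
  Real.sSup_nonneg (by rintro _ ⟨u, -, v, -, rfl⟩; exact dist_nonneg hpos u v)

theorem diam_le_diam_univ [Finite V] (hpos : ∀ e ∈ G.graph.edgeSet, 0 < G.len e) (S : Set V) :
    G.diam S ≤ G.diam Set.univ := by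
  refine Real.sSup_le ?_ (diam_nonneg hpos _)
  rintro _ ⟨u, -, v, -, rfl⟩
  exact dist_le_diam trivial trivial

theorem aspectRatio_nonneg (hpos : ∀ e ∈ G.graph.edgeSet, 0 < G.len e) : 0 ≤ G.aspectRatio :=
  div_nonneg (diam_nonneg hpos _)
    (Real.sInf_nonneg (by rintro _ ⟨u, v, -, rfl⟩; exact dist_nonneg hpos u v))

end WGraph

namespace Setup.Admissible

variable {V : Type*} {P : Setup V} {lam : ℝ} [Finite V] (hP : P.Admissible lam)

include hP

omit [Finite V] in
theorem minDist_pos [Nontrivial V] : 0 < P.G.minDist := by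
  obtain ⟨u, v, huv⟩ := exists_pair_ne V
  have h : P.c / 2 ≤ P.G.minDist := by
    refine le_csInf ⟨_, u, v, huv, rfl⟩ ?_
    rintro _ ⟨a, b, hab, rfl⟩
    exact (hP.scale a b hab).le
  linarith [hP.four_lt_c]

theorem one_le_aspectRatio [Nontrivial V] : 1 ≤ P.G.aspectRatio := by
  obtain ⟨u, v, huv⟩ := exists_pair_ne V
  rw [WGraph.aspectRatio, one_le_div hP.minDist_pos]
  refine le_trans ?_ (WGraph.dist_le_diam (Set.mem_univ u) (Set.mem_univ v))
  exact csInf_le ⟨0, by rintro _ ⟨a, b, -, rfl⟩; exact hP.dist_nonneg a b⟩ ⟨u, v, huv, rfl⟩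

theorem diam_univ_le [Nontrivial V] (hmin : P.G.minDist ≤ P.c) :
    P.G.diam Set.univ ≤ 8 * P.G.aspectRatio := by
  have h : P.G.diam Set.univ = P.G.aspectRatio * P.G.minDist := by
    rw [WGraph.aspectRatio, div_mul_cancel₀ _ hP.minDist_pos.ne']
  rw [h, mul_comm]
  exact mul_le_mul_of_nonneg_right (hmin.trans hP.c_le) (by linarith [hP.one_le_aspectRatio])

/-- Some shortest path between distinct vertices has to be hit, in a ball around one of its ends. -/
theorem one_le_highwayDimension [Nontrivial V] : 1 ≤ P.G.highwayDimension P.c := by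
  obtain ⟨u, v, huv⟩ := exists_pair_ne V
  have hd := hP.two_lt_dist huv
  obtain ⟨K, hK, hhit⟩ := WGraph.exists_hittingSet (G := P.G) P.c
    (show 0 < P.G.dist u v / 2 by linarith) u
  obtain ⟨p, hp⟩ := WGraph.exists_isShortestPath hP.conn hP.pos u v
  obtain ⟨h, hh, -⟩ := hhit u v p hp (fun z hz => by
    have h1 := hp.dist_add_dist hP.conn hP.pos hz
    have h2 := hP.dist_nonneg z v
    simp only [WGraph.ball, Set.mem_ofPred_eq]
    rw [P.G.dist_comm z u]
    nlinarith [hP.four_lt_c]) (by rw [hp.2]; linarith)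
  exact ((Set.ncard_pos (Set.toFinite K)).2 ⟨h, hh⟩).trans_le hK

theorem one_le_sparsity [Nontrivial V] {s : ℕ}
    (hs : ∀ i, P.G.LocallySparse P.c (P.r i) s (P.spc i)) : 1 ≤ s := by
  obtain ⟨u, v, huv⟩ := exists_pair_ne V
  obtain ⟨l, hl, hlt⟩ := hP.exists_scale (hP.two_lt_dist huv)
  have hr := hP.r_pos l
  obtain ⟨h, hh, -⟩ := hP.exists_hub hlt (by rw [r_succ] at hl; nlinarith [hP.four_lt_c])
  have hmem : h ∈ P.spc l ∩ P.G.ball h (P.c * P.r l / 2) := by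
    refine ⟨hh, ?_⟩
    simp only [WGraph.ball, Set.mem_ofPred_eq, hP.dist_self]
    nlinarith [hP.four_lt_c]
  exact ((Set.ncard_pos (Set.toFinite _)).2 ⟨h, hmem⟩).trans_le (hs l h)

theorem isTown_univ : P.IsTown Set.univ := by
  obtain ⟨i, hi⟩ := hP.exists_le_r (P.G.diam Set.univ)
  exact ⟨i, hP.isTownOn_univ fun u v => (WGraph.dist_le_diam (Set.mem_univ _) (Set.mem_univ _)).trans hi⟩

/-- The whole vertex set is a town on every level whose scale reaches the diameter, which is at most
`8 * α`. -/
theorem level_univ_le [Nontrivial V] (hmin : P.G.minDist ≤ P.c) :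
    (P.level Set.univ : ℝ) ≤ 8 * Real.log (8 * P.G.aspectRatio) / lam + 1 := by
  have hα := hP.one_le_aspectRatio
  rcases hn : P.level Set.univ with _ | n
  · have h1 : 0 ≤ Real.log (8 * P.G.aspectRatio) := Real.log_nonneg (by linarith)
    have := hP.lam_pos
    rw [Nat.cast_zero]
    positivity
  · push_cast
    refine add_le_add_left (le_of_lt (not_le.1 fun hle => ?_)) 1
    have h1 := Estimates.le_pow_of_log_le hP.lam_pos hP.lam_le (by linarith) hle
    rw [← hP.c_eq] at h1
    have h2 := level_le (hP.isTownOn_univ (i := n) fun u v =>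
      (WGraph.dist_le_diam (Set.mem_univ _) (Set.mem_univ _)).trans ((hP.diam_univ_le hmin).trans h1))
    omega

theorem top_le [Nontrivial V] (hmin : P.G.minDist ≤ P.c) (R : Choices V) (T : Set V) :
    R.top P T ≤ ⌈Real.logb 2 (8 * P.G.aspectRatio)⌉₊ := by
  refine Nat.ceil_le_ceil ?_
  have hα := hP.one_le_aspectRatio
  -- For diameter zero the logarithm has the default value `0`, outside the reach of monotonicity.
  rcases (WGraph.diam_nonneg hP.pos (R.Y P T)).eq_or_lt with h | h
  · rw [← h, Real.logb_zero]
    exact Real.logb_nonneg (by norm_num) (by linarith)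
  · exact Real.logb_le_logb_of_le (by norm_num) h
      ((WGraph.diam_le_diam_univ hP.pos _).trans (hP.diam_univ_le hmin))

end Setup.Admissible

/-! ### The main theorem -/

theorem mainTheorem4 (κ b A : ℝ) (hκ : 0 < κ) (hb : 0 < b) (hA : 0 < A) :
    ∃ K : ℝ, 0 < K ∧
      ∀ (V : Type*) [Finite V] [Nonempty V] (G : WGraph V) (c lam α : ℝ) (k s : ℕ)
        (spc : ℕ → Set V) (ε d β : ℝ),
        -- `G` is connected with positive edge lengths, highway dimension `k` of violation `lam`,
        -- and aspect ratio `α`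
        G.graph.Connected →
        (∀ e ∈ G.graph.edgeSet, 0 < G.len e) →
        c = 4 + lam → 0 < lam → lam ≤ 4 →
        k = G.highwayDimension c →
        α = G.aspectRatio →
        -- lengths are scaled such that the shortest distance is slightly more than `c / 2`
        (∀ u v : V, u ≠ v → c / 2 < G.dist u v) → G.minDist ≤ c →
        -- inclusion-wise minimal, locally `s`-sparse shortest path covers on all levels
        (∀ i : ℕ, Minimal (G.IsSPC c ((c / 4) ^ i)) (spc i)) →
        (∀ i : ℕ, G.LocallySparse c ((c / 4) ^ i) s (spc i)) →
        -- the parameters of the construction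
        0 < ε → ε ≤ 1 →
        1 ≤ d → d ≤ κ * Real.log (2 + k * s * Real.log (2 + 1 / ε) / lam) / lam →
        b * (ε ^ 2 / (d * Real.log (2 + α))) ≤ β →
        -- the construction can be carried out, and
        (∃ R : Choices V, R.Valid ⟨G, c, spc, ε, d, β⟩) ∧
        -- whatever choices it makes,
        ∀ R : Choices V, R.Valid ⟨G, c, spc, ε, d, β⟩ →
          -- for every town `T` of level `j`
          (∀ (T : Set V) (j : ℕ), IsLeast {i | Setup.IsTownOn ⟨G, c, spc, ε, d, β⟩ i T} j →
            -- the tree decomposition is valid,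
            IsTreeDecomposition T (R.embedding ⟨G, c, spc, ε, d, β⟩ T).graph
              (R.decompTree ⟨G, c, spc, ε, d, β⟩ T) (R.decompBag ⟨G, c, spc, ε, d, β⟩ T) ∧
            -- its width is bounded,
            (∀ n, ((R.decompBag ⟨G, c, spc, ε, d, β⟩ T n).ncard : ℝ) - 1 ≤
              j * Real.log (2 + α) ^ (K * Real.log (2 + k * s / (ε * lam)) ^ 2 / lam)) ∧
            -- and so is the treewidth of the embedding
            (treewidth T (R.embedding ⟨G, c, spc, ε, d, β⟩ T).graph : ℝ) ≤
              j * Real.log (2 + α) ^ (K * Real.log (2 + k * s / (ε * lam)) ^ 2 / lam)) ∧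
          -- the whole vertex set is a town, and its embedding has the treewidth of the main result
          Setup.IsTown ⟨G, c, spc, ε, d, β⟩ Set.univ ∧
          ((s : ℝ) ≤ A * (k * Real.log (2 + k)) →
            (treewidth Set.univ (R.embedding ⟨G, c, spc, ε, d, β⟩ Set.univ).graph : ℝ) ≤
              Real.log (2 + α) ^ (K * Real.log (2 + k / (ε * lam)) ^ 2 / lam)) := by
  obtain ⟨K₁, hK₁, hwidth⟩ := Estimates.exists_width_bound hκ hb
  obtain ⟨K₂, hK₂, hfinal⟩ := Estimates.exists_final_bound hA hK₁
  -- The sum serves both bounds: for at least two vertices the base exceeds `1`, so enlarging the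
  -- exponent is harmless.
  refine ⟨K₁ + K₂, by positivity, ?_⟩
  intro V _ _ G c lam α k s spc ε d β hconn hpos hc hlam hlam4 hk hα hscale hmin hminimal hsparse
    hε hε1 hd1 hd hβ
  set P : Setup V := ⟨G, c, spc, ε, d, β⟩ with hPdef
  have hP : P.Admissible lam :=
    ⟨hconn, hpos, hc, hlam, hlam4, hscale, hminimal, hε, hε1⟩
  have hα0 : 0 ≤ α := hα ▸ WGraph.aspectRatio_nonneg hpos
  have ha0 : 0 < Real.log (2 + α) := Real.log_pos (by linarith)
  have hβ0 : 0 ≤ β := le_trans (by positivity) hβ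
  refine ⟨⟨_, hP.valid_greedyChoices hβ0⟩, fun R hR => ?_⟩
  -- a bound for all bags, which also covers the case of a single vertex
  obtain ⟨B, hbag, hB, hB'⟩ : ∃ B : ℕ,
      (∀ T, P.IsTown T → ∀ n, {v | R.InBag P T n v}.ncard ≤ 1 + P.level T * B) ∧
      (B : ℝ) ≤ Real.log (2 + α) ^
        ((K₁ + K₂) * Real.log (2 + k * s / (ε * lam)) ^ 2 / lam) ∧
      ((s : ℝ) ≤ A * (k * Real.log (2 + k)) → (P.level Set.univ * B : ℝ) ≤
        Real.log (2 + α) ^ ((K₁ + K₂) * Real.log (2 + k / (ε * lam)) ^ 2 / lam)) := by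
    -- For a single vertex `α` is `0` by default and the base drops below `1`, so the estimates
    -- fail; but all towns have level `0` and `B = 0` works.
    rcases subsingleton_or_nontrivial V with hV | hV
    · have h0 : ∀ T, P.IsTown T → P.level T = 0 := by
        intro T hT
        obtain ⟨v, hv⟩ := hP.nonempty_of_isTown hT
        have : T = {v} := Set.eq_singleton_iff_unique_mem.2 ⟨hv, fun u _ => Subsingleton.elim u v⟩
        rw [this]
        exact hP.level_singleton v
      refine ⟨0, fun T hT n => ?_, ?_, fun _ => ?_⟩
      · simpa using Choices.ncard_bag_le_one hP hR hT (h0 T hT) n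
      · simpa using Real.rpow_nonneg ha0.le _
      · simpa using Real.rpow_nonneg ha0.le _
    · have hα1 : 1 ≤ α := hα ▸ hP.one_le_aspectRatio
      have I : Estimates.Input k s lam ε α :=
        ⟨hk ▸ hP.one_le_highwayDimension, hP.one_le_sparsity hsparse, hlam, hlam4, hε, hε1, hα1⟩
      have ha1 := I.one_lt_log
      obtain ⟨W, hW1, hW2, hW3⟩ := hwidth k s lam ε α d β I hd1 hd hβ
      rw [← hc] at hW1 hW2
      have hS : Choices.Scales P lam s W :=
        ⟨hsparse, hP.one_le_sparsity hsparse, hP.one_le_highwayDimension, hd1, hW1, hW2⟩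
      set t := ⌈Real.logb 2 (8 * α)⌉₊ with ht
      have ht4 : (t : ℝ) ≤ Real.logb 2 α + 4 := by
        have h1 : Real.logb 2 (8 * α) = 3 + Real.logb 2 α := by
          rw [Real.logb_mul (by norm_num) (by linarith), show (8 : ℝ) = 2 ^ 3 by norm_num,
            Real.logb_pow, Real.logb_self_eq_one (by norm_num)]
          norm_num
        have h2 : 0 ≤ Real.logb 2 (8 * α) := Real.logb_nonneg (by norm_num) (by linarith)
        have h3 := (Nat.ceil_lt_add_one h2).le
        linarith
      have hW4 := hW3 t ht4
      have hmono : ∀ x y : ℝ, x ≤ y → Real.log (2 + α) ^ x ≤ Real.log (2 + α) ^ y := fun x y h =>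
        Real.rpow_le_rpow_of_exponent_le ha1.le h
      refine ⟨(t + 3) * (Choices.packingNumber P lam s W * Choices.packingNumber P lam s W),
        fun T hT n => Choices.ncard_bag_le hP hR hS (fun T => ?_) hT n, ?_, fun hs => ?_⟩
      · rw [ht, hα]
        exact hP.top_le hmin R T
      · unfold Choices.packingNumber
        rw [← (show k = P.G.highwayDimension P.c from hk)]
        refine hW4.trans (hmono _ _ ?_)
        gcongr
        linarith
      · have hj := hP.level_univ_le hmin
        rw [← (show α = P.G.aspectRatio from hα)] at hj
        have h1 := hfinal k s (P.level Set.univ) lam ε α I hs hj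
        unfold Choices.packingNumber
        rw [← (show k = P.G.highwayDimension P.c from hk)]
        refine ((mul_le_mul_of_nonneg_left hW4 (Nat.cast_nonneg _)).trans h1).trans (hmono _ _ ?_)
        gcongr
        linarith
  have htree : ∀ T, P.IsTown T → IsTreeDecomposition T (R.embedding P T).graph
      (R.decompTree P T) (R.decompBag P T) := fun T hT => Choices.isTreeDecomposition hP hR hT
  have htw : ∀ T, P.IsTown T → treewidth T (R.embedding P T).graph ≤ P.level T * B := by
    intro T hT
    have : Finite {n : BagName V // R.IsName P T n} := Choices.finite_names hP hT
    refine treewidth_le (htree T hT) fun n => ?_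
    have : (R.decompBag P T n).ncard ≤ 1 + P.level T * B := hbag T hT n.1
    omega
  refine ⟨fun T j hj => ?_, hP.isTown_univ, fun hs => ?_⟩
  · have hT : P.IsTown T := ⟨j, hj.1⟩
    have hlev : P.level T = j := hj.csInf_eq
    have hle : ((P.level T * B : ℕ) : ℝ) ≤ j * Real.log (2 + α) ^
        ((K₁ + K₂) * Real.log (2 + k * s / (ε * lam)) ^ 2 / lam) := by
      rw [hlev, Nat.cast_mul]
      exact mul_le_mul_of_nonneg_left hB (Nat.cast_nonneg _)
    refine ⟨htree T hT, fun n => ?_, ?_⟩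
    · have h : (((R.decompBag P T n).ncard : ℕ) : ℝ) ≤ ((1 + P.level T * B : ℕ) : ℝ) := by
        exact_mod_cast hbag T hT n.1
      rw [Nat.cast_add, Nat.cast_one] at h
      linarith
    · exact (Nat.cast_le.2 (htw T hT)).trans hle
  · refine le_trans ?_ (hB' hs)
    exact_mod_cast htw Set.univ hP.isTown_univ
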